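/- **Setting.** Let $A$ be a unital $C^*$-algebra, $\alpha\in\mathrm{Aut}(A)$, and let $A\rtimes_\alpha\mathbb Z$ be the full crossed product, generated by $A$ and a unitary $u$ with $uau^*=\alpha(a)$. For a unital representation $\pi:A\to B(H)$ let $\hat\pi$ be the representation of $A\rtimes_\alpha\mathbb Z$ on $\ell^2(\mathbb Z)\otimes H$ with $$\hat\pi(a)(e_m\otimes\xi)=e_m\otimes\pi(\alpha^{-m}(a))\xi,\qquad \hat\pi(u)(e_m\otimes\xi)=e_{m+1}\otimes\xi .$$ An odd Fredholm module $(K,\rho,F)$ over a $C^*$-algebra $B$ is a representation $\rho$ of $B$ on a separable Hilbert space $K$ with an operator $F\in B(K)$ such that $(F^2-1)\rho(b)$, $(F-F^*)\rho(b)$, $[F,\rho(b)]$ are compact for all $b\in B$. It is $p$-summable on a dense subalgebra $\mathscr B\subseteq B$ if $\rho(b)(F^2-1),\ \rho(b)(F-F^*)\in L^{p/2}(K)$ and $[F,\rho(b)]\in L^p(K)$ (Schatten classes) for all $b\in\mathscr B$. Let $\langle\cdot,\cdot\rangle:K_1(B)\times K^1(B)\to\mathbb Z$ be the index pairing, $\langle[v],[K,\rho,F]\rangle=\operatorname{Index}\bigl(P\rho(v)P+(1-P)\bigr)$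 with $P=\tfrac12(1+F)$ for $\rho$ unital ($v$ a unitary matrix over $B$). Write $C_c(\mathbb Z,A)=\{\sum_{k=L}^{K}a_ku^k: a_k\in A\}\subseteq A\rtimes_\alpha\mathbb Z$. A homeomorphism $\varphi$ of a compact space $X$ acts on $C(X)$ by $f\mapsto f\circ\varphi^{-1}$. **(1)** Let $X$ be a compact Hausdorff space, $\varphi:X\to X$ a homeomorphism, and $\pi:C(X)\to B(H)$ a unital representation on a separable Hilbert space that has an orthonormal basis $(\delta_n)_{n\in J}$ of simultaneous eigenvectors of all $\pi(f)$, $f\in C(X)$. Let $N\subseteq J$ be finite, and let $P_N$ and $P_N'$ be the orthogonal projections of $\ell^2(\mathbb Z)\otimes H$ onto the closed spans of $\{e_m\otimes\delta_n: m>0,\ n\in N\}$ and of $\{e_m\otimes\delta_n: m<0,\ n\in N\}$. Then $(\ell^2(\mathbb Z)\otimes H,\hat\pi,2P_N-1)$ and $(\ell^2(\mathbb Z)\otimes H,\hat\pi,2P_N'-1)$ are odd Fredholm modules over $C(X)\rtimes_\varphi\mathbb Z$, they are $p$-summable on $C_c(\mathbb Z,C(X))$ for every $p>0$, and $$\langle[u],[\ell^2(\mathbb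 Z)\otimes H,\hat\pi,2P_N-1]\rangle=-|N|,\qquad \langle[u],[\ell^2(\mathbb Z)\otimes H,\hat\pi,2P_N'-1]\rangle=+|N|.$$ **(2)** Let $\Omega$ be a finite alphabet and $X=\Omega^{\mathbb N}$ or $X=\Omega^{\mathbb Z}$. For a word $\mu$ let $C_\mu\subseteq X$ be its cylinder set: the sequences that begin with $\mu$ if $X=\Omega^{\mathbb N}$, and those in which $\mu$ is the word of length $|\mu|$ that starts at position $-\lfloor(|\mu|-1)/2\rfloor$ if $X=\Omega^{\mathbb Z}$. Let $\varphi:X\to X$ be a homeomorphism (in particular, a minimal one), $Y$ a set of finite words (for instance all of them), $\tau:Y\to X$ a function with $\tau(\mu)\in C_\mu$ for all $\mu\in Y$, and let $\pi_\tau(f)\xi(\nu)=f(\tau(\nu))\xi(\nu)$ be the representation of $C(X)$ on $\ell^2(Y)$, with $(\delta_\mu)_{\mu\in Y}$ the standard basis. Let $N\subseteq Y$ be finite, and let $P_N$ and $P'_N$ be the orthogonal projections onto the closed spans of the $e_n\otimes\delta_\mu$ with $\mu\in N$ and $n\ge 0$, respectively $n\le 0$. Then $(\ell^2(\mathbb Z)\otimes\ell^2(Y),\hat\pi_\tau,2P_N-1)$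 and $(\ell^2(\mathbb Z)\otimes\ell^2(Y),\hat\pi_\tau,2P'_N-1)$ are odd Fredholm modules over $C(X)\rtimes_\varphi\mathbb Z$ that are $p$-summable on $C_c(\mathbb Z,C(X))$ for every $p>0$, and their pairings with $[u]\in K_1(C(X)\rtimes_\varphi\mathbb Z)$ are $-|N|$ and $+|N|$ respectively. -/

import Mathlib

universe u v

noncomputable section

open Module

/-- The index `dim ker T - dim coker T`. -/
def fredholmIndex {E F : Type*} [AddCommGroup E] [Module ℂ E] [AddCommGroup F] [Module ℂ F]
    (T : E →ₗ[ℂ] F) : ℤ :=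
  (finrank ℂ (LinearMap.ker T) : ℤ) - (finrank ℂ (F ⧸ LinearMap.range T) : ℤ)

theorem fredholmIndex_of_corner {E F : Type*} [AddCommGroup E] [Module ℂ E] [AddCommGroup F]
    [Module ℂ F] (T : E →ₗ[ℂ] F) {E₁ E₀ : Submodule ℂ E} {F₁ F₀ : Submodule ℂ F}
    (hE : IsCompl E₁ E₀) (hF : IsCompl F₁ F₀) [FiniteDimensional ℂ E₀] [FiniteDimensional ℂ F₀]
    (hb : Function.Bijective ((F₁.projectionOnto F₀ hF ∘ₗ T) ∘ₗ E₁.subtype)) :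
    fredholmIndex T = (finrank ℂ E₀ : ℤ) - (finrank ℂ F₀ : ℤ) := by
  set g : E →ₗ[ℂ] F₁ := F₁.projectionOnto F₀ hF ∘ₗ T with hg
  have hN : IsCompl E₁ (LinearMap.ker g) := by
    rw [isCompl_iff]
    constructor
    · rw [Submodule.disjoint_def]
      intro x hx hx'
      have := hb.1 (a₁ := ⟨x, hx⟩) (a₂ := 0) (by simpa using hx')
      simpa using congrArg Subtype.val this
    · rw [codisjoint_iff, eq_top_iff]
      intro x _
      obtain ⟨y, hy⟩ := hb.2 (g x)
      have hy' : g y = g x := hy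
      refine Submodule.mem_sup.2 ⟨y, y.2, x - y, ?_, by abel⟩
      simp [LinearMap.mem_ker, map_sub, hy']
  let eN : LinearMap.ker g ≃ₗ[ℂ] E₀ :=
    (Submodule.quotientEquivOfIsCompl _ _ hN).symm.trans (Submodule.quotientEquivOfIsCompl _ _ hE)
  have hNfd : FiniteDimensional ℂ (LinearMap.ker g) := eN.symm.finiteDimensional
  have hmap : ∀ x ∈ LinearMap.ker g, T x ∈ F₀ := by
    intro x hx
    exact (Submodule.projectionOnto_apply_eq_zero_iff hF).1 hx
  let S : LinearMap.ker g →ₗ[ℂ] F₀ := T.restrict hmap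
  have hker : (LinearMap.ker S).map (LinearMap.ker g).subtype = LinearMap.ker T := by
    ext x
    constructor
    · rintro ⟨y, hy, rfl⟩
      have := congrArg Subtype.val (LinearMap.mem_ker.1 hy)
      simpa [S] using this
    · intro hx
      have hx' : T x = 0 := hx
      refine ⟨⟨x, by simp [hg, hx']⟩, ?_, rfl⟩
      apply Subtype.ext
      simpa [S] using hx'
  have hk : finrank ℂ (LinearMap.ker S) = finrank ℂ (LinearMap.ker T) := by
    rw [← hker]
    exact (Submodule.equivMapOfInjective _ (Submodule.injective_subtype _) _).finrank_eq
  let c : F₀ →ₗ[ℂ] F ⧸ LinearMap.range T := (LinearMap.range T).mkQ ∘ₗ F₀.subtype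
  have hcs : Function.Surjective c := by
    intro z
    obtain ⟨y, rfl⟩ := Submodule.Quotient.mk_surjective _ z
    obtain ⟨x, hx⟩ := hb.2 (F₁.projectionOnto F₀ hF y)
    have hx' : F₁.projectionOnto F₀ hF (T x) = F₁.projectionOnto F₀ hF y := hx
    refine ⟨⟨y - T x, (Submodule.projectionOnto_apply_eq_zero_iff hF).1 ?_⟩, ?_⟩
    · rw [map_sub, hx', sub_self]
    · simp [c]
  have hck : LinearMap.ker c = LinearMap.range S := by
    ext y
    constructor
    · intro hy
      have hy' : (y : F) ∈ LinearMap.range T := by simpa [c] using hy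
      obtain ⟨x, hx⟩ := hy'
      have hxg : x ∈ LinearMap.ker g := by
        show F₁.projectionOnto F₀ hF (T x) = 0
        rw [hx]
        exact (Submodule.projectionOnto_apply_eq_zero_iff hF).2 y.2
      exact ⟨⟨x, hxg⟩, Subtype.ext hx⟩
    · rintro ⟨x, rfl⟩
      have : T (x : E) ∈ LinearMap.range T := ⟨x, rfl⟩
      simp [c, S, this]
  have hc : finrank ℂ (F₀ ⧸ LinearMap.range S) = finrank ℂ (F ⧸ LinearMap.range T) := by
    rw [← hck]
    exact (c.quotKerEquivOfSurjective hcs).finrank_eq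
  have h1 := LinearMap.finrank_range_add_finrank_ker S
  have h2 := Submodule.finrank_quotient_add_finrank (LinearMap.range S)
  have h3 := eN.finrank_eq
  unfold fredholmIndex
  omega

section Norm
variable {E F G : Type*} [NormedAddCommGroup E] [NormedSpace ℂ E] [CompleteSpace E]
  [NormedAddCommGroup F] [NormedSpace ℂ F] [CompleteSpace F]

open Topology

theorem fredholmIndex_eventually_eq (T : E →L[ℂ] F) (hT : T.IsFredholm) :
    ∀ᶠ S : E →L[ℂ] F in 𝓝 T, fredholmIndex (S : E →ₗ[ℂ] F) = fredholmIndex (T : E →ₗ[ℂ] F) := by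
  obtain ⟨pkg⟩ := hT.nonempty_fredholmPackage
  have := pkg.decDom.finite_X₀
  have := pkg.decCodom.finite_X₀
  have hc1 : IsClosed (pkg.decDom.X₁ : Set E) := pkg.decDom.isTopCompl.isClosed
  have hc2 : IsClosed (pkg.decCodom.X₁ : Set F) := pkg.decCodom.isTopCompl.isClosed
  have : CompleteSpace pkg.decDom.X₁ := hc1.completeSpace_coe
  have : CompleteSpace pkg.decCodom.X₁ := hc2.completeSpace_coe
  let Φ : (E →L[ℂ] F) → (pkg.decDom.X₁ →L[ℂ] pkg.decCodom.X₁) := fun S =>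
    pkg.decCodom.proj ∘L S ∘L pkg.decDom.X₁.subtypeL
  have hΦ : Continuous Φ := by fun_prop
  have hT1 : Φ T = pkg.equiv := by
    ext x
    have := congrArg (fun R : E →L[ℂ] F => R x) pkg.eq_equiv
    simp only [ContinuousLinearMap.comp_apply] at this
    simp [Φ, this]
  have key : ∀ S : E →L[ℂ] F, Φ S ∈ Set.range ((↑) : (pkg.decDom.X₁ ≃L[ℂ] pkg.decCodom.X₁) → _) →
      fredholmIndex (S : E →ₗ[ℂ] F) =
        (finrank ℂ pkg.decDom.X₀ : ℤ) - (finrank ℂ pkg.decCodom.X₀ : ℤ) := by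
    rintro S ⟨e, he⟩
    refine fredholmIndex_of_corner (S : E →ₗ[ℂ] F) pkg.decDom.isTopCompl.isCompl
      pkg.decCodom.isTopCompl.isCompl ?_
    have : ⇑((pkg.decCodom.X₁.projectionOnto pkg.decCodom.X₀ pkg.decCodom.isTopCompl.isCompl ∘ₗ
        (S : E →ₗ[ℂ] F)) ∘ₗ pkg.decDom.X₁.subtype) = ⇑e := by
      funext x
      exact (congrArg (fun R : pkg.decDom.X₁ →L[ℂ] pkg.decCodom.X₁ => R x) he).symm
    rw [this]
    exact e.bijective
  have hopen := ContinuousLinearEquiv.nhds pkg.equiv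
  rw [← hT1] at hopen
  filter_upwards [hΦ.continuousAt.preimage_mem_nhds hopen] with S hS
  rw [key S hS, key T (by rw [hT1]; exact ⟨_, rfl⟩)]

theorem fredholmIndex_eq_of_path {Z : Type*} [TopologicalSpace Z] [PreconnectedSpace Z]
    (γ : Z → (E →L[ℂ] F)) (hγ : Continuous γ) (hf : ∀ t, (γ t).IsFredholm) (s t : Z) :
    fredholmIndex (γ s : E →ₗ[ℂ] F) = fredholmIndex (γ t : E →ₗ[ℂ] F) := by
  have : IsLocallyConstant fun t => fredholmIndex (γ t : E →ₗ[ℂ] F) := by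
    rw [IsLocallyConstant.iff_eventually_eq]
    intro t
    exact hγ.continuousAt.eventually (fredholmIndex_eventually_eq (γ t) (hf t))
  exact this.apply_eq_of_preconnectedSpace s t

end Norm

theorem fredholmIndex_conj {E F E' F' : Type*} [AddCommGroup E] [Module ℂ E] [AddCommGroup F]
    [Module ℂ F] [AddCommGroup E'] [Module ℂ E'] [AddCommGroup F'] [Module ℂ F']
    (T : E →ₗ[ℂ] F) (T' : E' →ₗ[ℂ] F') (a : E ≃ₗ[ℂ] E') (b : F ≃ₗ[ℂ] F')
    (h : ∀ x, b (T x) = T' (a x)) : fredholmIndex T = fredholmIndex T' := by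
  have hk : (LinearMap.ker T).map (a : E →ₗ[ℂ] E') = LinearMap.ker T' := by
    ext y
    constructor
    · rintro ⟨x, hx, rfl⟩
      have hx' : T x = 0 := hx
      show T' (a x) = 0
      rw [← h, hx', map_zero]
    · intro hy
      refine ⟨a.symm y, ?_, by simp⟩
      have hy' : T' y = 0 := hy
      show T (a.symm y) = 0
      apply b.injective
      rw [h, a.apply_symm_apply, hy', map_zero]
  have hr : (LinearMap.range T).map (b : F →ₗ[ℂ] F') = LinearMap.range T' := by
    ext y
    constructor
    · rintro ⟨_, ⟨x, rfl⟩, rfl⟩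
      exact ⟨a x, (h x).symm⟩
    · rintro ⟨x, rfl⟩
      exact ⟨T (a.symm x), ⟨_, rfl⟩, by simp [h]⟩
  have h1 := (a.submoduleMap (LinearMap.ker T)).finrank_eq
  have h2 := (Submodule.Quotient.equiv _ _ b hr).finrank_eq
  rw [hk] at h1
  unfold fredholmIndex
  rw [h1, h2]

theorem fredholmIndex_prodMap {E F E' F' : Type*} [AddCommGroup E] [Module ℂ E] [AddCommGroup F]
    [Module ℂ F] [AddCommGroup E'] [Module ℂ E'] [AddCommGroup F'] [Module ℂ F']
    (T : E →ₗ[ℂ] F) (S : E' →ₗ[ℂ] F')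
    [FiniteDimensional ℂ (LinearMap.ker T)] [FiniteDimensional ℂ (LinearMap.ker S)]
    [FiniteDimensional ℂ (F ⧸ LinearMap.range T)] [FiniteDimensional ℂ (F' ⧸ LinearMap.range S)] :
    fredholmIndex (T.prodMap S) = fredholmIndex T + fredholmIndex S := by
  have hk : finrank ℂ (LinearMap.ker (T.prodMap S))
      = finrank ℂ (LinearMap.ker T) + finrank ℂ (LinearMap.ker S) := by
    let e : LinearMap.ker (T.prodMap S) ≃ₗ[ℂ] LinearMap.ker T × LinearMap.ker S :=
      { toFun := fun x => (⟨x.1.1, congrArg Prod.fst x.2⟩, ⟨x.1.2, congrArg Prod.snd x.2⟩)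
        map_add' := fun _ _ => rfl
        map_smul' := fun _ _ => rfl
        invFun := fun y => ⟨(y.1.1, y.2.1), Prod.ext y.1.2 y.2.2⟩
        left_inv := fun _ => rfl
        right_inv := fun _ => rfl }
    rw [e.finrank_eq, finrank_prod]
  let c : F × F' →ₗ[ℂ] (F ⧸ LinearMap.range T) × (F' ⧸ LinearMap.range S) :=
    (LinearMap.range T).mkQ.prodMap (LinearMap.range S).mkQ
  have hcs : Function.Surjective c :=
    Prod.map_surjective.2 ⟨Submodule.mkQ_surjective _, Submodule.mkQ_surjective _⟩
  have hck : LinearMap.ker c = LinearMap.range (T.prodMap S) := by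
    rw [LinearMap.ker_prodMap, LinearMap.range_prodMap, Submodule.ker_mkQ, Submodule.ker_mkQ]
  have hc : finrank ℂ ((F × F') ⧸ LinearMap.range (T.prodMap S))
      = finrank ℂ (F ⧸ LinearMap.range T) + finrank ℂ (F' ⧸ LinearMap.range S) := by
    rw [← hck, (c.quotKerEquivOfSurjective hcs).finrank_eq, finrank_prod]
  unfold fredholmIndex
  rw [hk, hc]
  push_cast
  ring

section Compact

open Topology

/-- Modulo operators of small norm, compact operators into a Hilbert space have finite rank. -/
theorem IsCompactOperator.exists_finiteRank_approx {H : Type*} [NormedAddCommGroup H]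
    [InnerProductSpace ℂ H] [CompleteSpace H] {K : H →L[ℂ] H} (hK : IsCompactOperator K)
    {ε : ℝ} (hε : 0 < ε) :
    ∃ R : H →L[ℂ] H, FiniteDimensional ℂ (LinearMap.range (R : H →ₗ[ℂ] H)) ∧ ‖K - R‖ ≤ ε := by
  have hc : IsCompact (closure (K '' Metric.closedBall 0 1)) :=
    hK.isCompact_closure_image_closedBall (𝕜₁ := ℂ) (f := (K : H →ₗ[ℂ] H)) 1
  obtain ⟨t, -, htf, ht⟩ := Metric.totallyBounded_iff.1 hc.totallyBounded ε hε |>.imp fun t h =>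
    (⟨trivial, h.1, h.2⟩ : True ∧ _ ∧ _)
  let W : Submodule ℂ H := Submodule.span ℂ t
  have : FiniteDimensional ℂ W := FiniteDimensional.span_of_finite ℂ htf
  refine ⟨W.starProjection ∘L K, ?_, ?_⟩
  · refine Submodule.finiteDimensional_of_le (S₂ := W) ?_
    rintro _ ⟨x, rfl⟩
    exact Submodule.starProjection_apply_mem W (K x)
  · have hb : ∀ x : H, ‖x‖ ≤ 1 → ‖(K - W.starProjection ∘L K) x‖ ≤ ε := by
      intro x hx
      have hx' : K x ∈ closure (K '' Metric.closedBall 0 1) :=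
        subset_closure ⟨x, by simpa using hx, rfl⟩
      obtain ⟨y, hy, hxy⟩ := Set.mem_iUnion₂.1 (ht hx')
      have hyW : y ∈ W := Submodule.subset_span hy
      have h1 : ‖K x - W.starProjection (K x)‖ ≤ ‖K x - y‖ := by
        rw [Submodule.starProjection_minimal]
        exact ciInf_le ⟨0, by rintro _ ⟨z, rfl⟩; positivity⟩ (⟨y, hyW⟩ : W)
      refine h1.trans ?_
      rw [← dist_eq_norm]
      exact (Metric.mem_ball.1 hxy).le
    refine ContinuousLinearMap.opNorm_le_of_unit_norm hε.le fun x hx => hb x hx.le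

open LinearMap.FiniteRangeSetoid in
theorem isFredholm_one_add_of_isCompactOperator {H : Type*} [NormedAddCommGroup H]
    [InnerProductSpace ℂ H] [CompleteSpace H] {K : H →L[ℂ] H} (hK : IsCompactOperator K) :
    (1 + K).IsFredholm := by
  obtain ⟨R, hR, hKR⟩ := hK.exists_finiteRank_approx (ε := 1 / 2) (by norm_num)
  have hu : IsUnit (1 + (K - R)) := by
    have := isUnit_one_sub_of_norm_lt_one (x := -(K - R)) (by rw [norm_neg]; linarith)
    rwa [sub_neg_eq_add] at this
  obtain ⟨v, hv⟩ := hu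
  refine ContinuousLinearMap.IsFredholm.of_isQuasiInverse (v := (↑v⁻¹ : H →L[ℂ] H)) ?_
  have h1 : ((1 + K : H →L[ℂ] H) : H →ₗ[ℂ] H) ≈ ((v : H →L[ℂ] H) : H →ₗ[ℂ] H) := by
    rw [LinearMap.FiniteRangeSetoid.equiv_iff_hasFiniteRange, hv,
      LinearMap.hasFiniteRange_iff_range]
    have : ((1 + K : H →L[ℂ] H) : H →ₗ[ℂ] H) - ((1 + (K - R) : H →L[ℂ] H) : H →ₗ[ℂ] H)
        = (R : H →ₗ[ℂ] H) := by ext x; simp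
    rw [this]
    exact Module.Finite.iff_fg.1 hR
  refine LinearMap.IsQuasiInverse.congr (u := ((↑v⁻¹ : H →L[ℂ] H) : H →ₗ[ℂ] H))
    (v := ((v : H →L[ℂ] H) : H →ₗ[ℂ] H)) ⟨?_, ?_⟩ (Setoid.refl _) h1
  · have : ((↑v⁻¹ : H →L[ℂ] H) : H →ₗ[ℂ] H) ∘ₗ ((v : H →L[ℂ] H) : H →ₗ[ℂ] H) = LinearMap.id := by
      ext x
      exact congrArg (fun T : H →L[ℂ] H => T x) v.inv_mul
    show _ ≈ _
    rw [this]
  · have : ((v : H →L[ℂ] H) : H →ₗ[ℂ] H) ∘ₗ ((↑v⁻¹ : H →L[ℂ] H) : H →ₗ[ℂ] H) = LinearMap.id := by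
      ext x
      exact congrArg (fun T : H →L[ℂ] H => T x) v.mul_inv
    show _ ≈ _
    rw [this]

open LinearMap.FiniteRangeSetoid in
/-- An operator which is invertible modulo the compact operators is Fredholm. -/
theorem isFredholm_of_isCompactOperator {H : Type*} [NormedAddCommGroup H]
    [InnerProductSpace ℂ H] [CompleteSpace H] {T S : H →L[ℂ] H}
    (h₁ : IsCompactOperator (S * T - 1 : H →L[ℂ] H))
    (h₂ : IsCompactOperator (T * S - 1 : H →L[ℂ] H)) :
    T.IsFredholm := by
  have f₁ := isFredholm_one_add_of_isCompactOperator h₁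
  have f₂ := isFredholm_one_add_of_isCompactOperator h₂
  rw [add_sub_cancel] at f₁ f₂
  obtain ⟨a, ha⟩ := f₁.exists_isQuasiInverse
  obtain ⟨b, hb⟩ := f₂.exists_isQuasiInverse
  -- `a ∘ S` is a left and `S ∘ b` a right quasi-inverse of `T`
  have l : (a ∘L S : H →ₗ[ℂ] H).IsLeftQuasiInverse (T : H →ₗ[ℂ] H) := ha.1
  have r : (S ∘L b : H →ₗ[ℂ] H).IsRightQuasiInverse (T : H →ₗ[ℂ] H) := hb.2
  refine ContinuousLinearMap.IsFredholm.of_isQuasiInverse (v := a ∘L S) ⟨l, ?_⟩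
  have e : (a ∘L S : H →ₗ[ℂ] H) ≈ (S ∘L b : H →ₗ[ℂ] H) := by
    calc (a ∘L S : H →ₗ[ℂ] H) = (a ∘L S : H →ₗ[ℂ] H) ∘ₗ LinearMap.id := rfl
      _ ≈ (a ∘L S : H →ₗ[ℂ] H) ∘ₗ ((T : H →ₗ[ℂ] H) ∘ₗ (S ∘L b : H →ₗ[ℂ] H)) := by
        grw [r.equiv]
      _ = ((a ∘L S : H →ₗ[ℂ] H) ∘ₗ (T : H →ₗ[ℂ] H)) ∘ₗ (S ∘L b : H →ₗ[ℂ] H) := rfl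
      _ ≈ LinearMap.id ∘ₗ (S ∘L b : H →ₗ[ℂ] H) := by grw [l.equiv]
      _ = (S ∘L b : H →ₗ[ℂ] H) := rfl
  exact r.congr e (Setoid.refl _)

/-- A compact perturbation of the identity has index zero. -/
theorem fredholmIndex_one_add_of_isCompactOperator {H : Type*} [NormedAddCommGroup H]
    [InnerProductSpace ℂ H] [CompleteSpace H] {K : H →L[ℂ] H} (hK : IsCompactOperator K) :
    fredholmIndex ((1 + K : H →L[ℂ] H) : H →ₗ[ℂ] H) = 0 := by
  have := fredholmIndex_eq_of_path (Z := ℝ) (fun t => 1 + (t : ℂ) • K) (by fun_prop)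
    (fun t => isFredholm_one_add_of_isCompactOperator (hK.smul (t : ℂ))) 1 0
  simp only [Complex.ofReal_one, one_smul, Complex.ofReal_zero, zero_smul, add_zero] at this
  rw [this]
  have hr : LinearMap.range ((1 : H →L[ℂ] H) : H →ₗ[ℂ] H) = ⊤ :=
    LinearMap.range_eq_top.2 fun x => ⟨x, rfl⟩
  have hk : LinearMap.ker ((1 : H →L[ℂ] H) : H →ₗ[ℂ] H) = ⊥ :=
    LinearMap.ker_eq_bot.2 fun x y h => h
  unfold fredholmIndex
  rw [hk, hr]
  have : Subsingleton (H ⧸ (⊤ : Submodule ℂ H)) := Submodule.Quotient.subsingleton_iff.2 rfl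
  simp [finrank_zero_of_subsingleton]

end Compact

section FredholmModule

/-- Odd (ungraded) Fredholm modules `(H, ρ, F)` over a C⋆-algebra `A`. -/
structure IsOddFredholmModule {A : Type*} [CStarAlgebra A] {H : Type*} [NormedAddCommGroup H]
    [InnerProductSpace ℂ H] [CompleteSpace H] (ρ : A →⋆ₙₐ[ℂ] (H →L[ℂ] H)) (F : H →L[ℂ] H) :
    Prop where
  separable : TopologicalSpace.SeparableSpace H
  sq_sub_one : ∀ a, IsCompactOperator ((F * F - 1) * ρ a : H →L[ℂ] H)
  sub_star : ∀ a, IsCompactOperator ((F - star F) * ρ a : H →L[ℂ] H)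
  commutator : ∀ a, IsCompactOperator (F * ρ a - ρ a * F : H →L[ℂ] H)

section MatrixOperators

variable {H : Type*} [NormedAddCommGroup H] [InnerProductSpace ℂ H] {k : ℕ}

/-- The operator on `Hᵏ` given by a `k × k` matrix of operators on `H`. -/
def matOp (M : Matrix (Fin k) (Fin k) (H →L[ℂ] H)) :
    PiLp 2 (fun _ : Fin k => H) →L[ℂ] PiLp 2 (fun _ : Fin k => H) :=
  ∑ i, ∑ j, ((PiLp.continuousLinearEquiv 2 ℂ (fun _ : Fin k => H)).symm :
      (Fin k → H) →L[ℂ] PiLp 2 (fun _ : Fin k => H)) ∘L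
    ContinuousLinearMap.single ℂ (fun _ : Fin k => H) i ∘L M i j ∘L PiLp.proj 2 (fun _ => H) j

theorem matOp_apply (M : Matrix (Fin k) (Fin k) (H →L[ℂ] H)) (x : PiLp 2 (fun _ : Fin k => H))
    (i : Fin k) : matOp M x i = ∑ j, M i j (x j) := by
  simp only [matOp, _root_.sum_apply, ContinuousLinearMap.comp_apply,
    WithLp.ofLp_sum, Finset.sum_apply]
  rw [Finset.sum_eq_single i]
  · simp
  · intro b _ hb
    simp [hb.symm]
  · simp

theorem matOp_mul (M N : Matrix (Fin k) (Fin k) (H →L[ℂ] H)) :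
    matOp (M * N) = matOp M * matOp N := by
  ext x i
  have : (matOp M * matOp N) x = matOp M (matOp N x) := rfl
  rw [this, matOp_apply, matOp_apply]
  simp only [Matrix.mul_apply, _root_.sum_apply, matOp_apply, map_sum]
  rw [Finset.sum_comm]
  rfl

theorem matOp_one : matOp (1 : Matrix (Fin k) (Fin k) (H →L[ℂ] H)) = 1 := by
  ext x i
  rw [matOp_apply]
  simp only [Matrix.one_apply]
  rw [Finset.sum_eq_single i]
  · simp
  · intro b _ hb
    simp [hb.symm]
  · simp

theorem matOp_sub (M N : Matrix (Fin k) (Fin k) (H →L[ℂ] H)) :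
    matOp (M - N) = matOp M - matOp N := by
  ext x i
  simp [matOp_apply]

theorem matOp_isCompact {M : Matrix (Fin k) (Fin k) (H →L[ℂ] H)}
    (hM : ∀ i j, IsCompactOperator (M i j)) : IsCompactOperator (matOp M) := by
  have : matOp M ∈ compactOperator (RingHom.id ℂ) (PiLp 2 (fun _ : Fin k => H))
      (PiLp 2 (fun _ : Fin k => H)) := by
    refine Submodule.sum_mem _ fun i _ => Submodule.sum_mem _ fun j _ => ?_
    have h1 : IsCompactOperator (M i j ∘L PiLp.proj (𝕜 := ℂ) 2 (fun _ : Fin k => H) j) :=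
      (hM i j).comp_clm _
    exact (h1.clm_comp (ContinuousLinearMap.single ℂ (fun _ : Fin k => H) i)).clm_comp
      ((PiLp.continuousLinearEquiv 2 ℂ (fun _ : Fin k => H)).symm :
        (Fin k → H) →L[ℂ] PiLp 2 (fun _ : Fin k => H))
  exact this

end MatrixOperators

theorem halfProj_aux {R : Type*} [Ring R] [Algebra ℂ R] (e F : R) (he : e * e = e) :
    ((1 / 2 : ℂ) • (e * (1 + F) * e)) * ((1 / 2 : ℂ) • (e * (1 + F) * e))
        - (1 / 2 : ℂ) • (e * (1 + F) * e)
      = (1 / 4 : ℂ) • (e * ((F * F - 1) * e) - e * (1 + F) * (F * e - e * F) * e) := by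
  have he' : ∀ x, e * (e * x) = e * x := fun x => by rw [← mul_assoc, he]
  have e1 : e * (1 + F) * e = e + e * (F * e) := by
    simp only [mul_add, add_mul, mul_one, he, mul_assoc]
  have e2 : (e + e * (F * e)) * (e + e * (F * e))
      = e + (2 : ℂ) • (e * (F * e)) + e * (F * (e * (F * e))) := by
    simp only [mul_add, add_mul, he, he', mul_assoc, two_smul]
    abel
  have e3 : e * ((F * F - 1) * e) - e * (1 + F) * (F * e - e * F) * e
      = e * (F * (e * (F * e))) - e := by
    simp only [mul_add, add_mul, mul_sub, sub_mul, mul_one, one_mul, he, he', mul_assoc]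
    abel
  rw [e1, smul_mul_smul_comm, e2, e3]
  module

/-- The ideal of compact operators. -/
def compactIdeal (H : Type*) [NormedAddCommGroup H] [InnerProductSpace ℂ H] :
    TwoSidedIdeal (H →L[ℂ] H) :=
  TwoSidedIdeal.mk' {T | IsCompactOperator T} isCompactOperator_zero (fun h h' => h.add h')
    (fun h => h.neg) (fun {x _} h => h.clm_comp x) (fun {_ y} h => h.comp_clm y)

theorem mem_compactIdeal {H : Type*} [NormedAddCommGroup H] [InnerProductSpace ℂ H]
    {T : H →L[ℂ] H} : T ∈ compactIdeal H ↔ IsCompactOperator T :=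
  TwoSidedIdeal.mem_mk' _ _ _ _ _ _ _

/-- The quotient map onto the Calkin algebra. -/
def toCalkin (H : Type*) [NormedAddCommGroup H] [InnerProductSpace ℂ H] :
    (H →L[ℂ] H) →+* (compactIdeal H).ringCon.Quotient :=
  (compactIdeal H).ringCon.mk'

theorem toCalkin_eq {H : Type*} [NormedAddCommGroup H] [InnerProductSpace ℂ H]
    {S T : H →L[ℂ] H} :
    toCalkin H S = toCalkin H T ↔ IsCompactOperator (S - T : H →L[ℂ] H) := by
  rw [← mem_compactIdeal, ← TwoSidedIdeal.rel_iff]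
  exact RingCon.eq _

variable {A : Type*} [CStarAlgebra A] {H : Type*} [NormedAddCommGroup H] [InnerProductSpace ℂ H]
  [CompleteSpace H]

/-- The operator `P = ρ(1) ((1 + F) / 2) ρ(1)` of a Fredholm module `(H, ρ, F)`; this is
`(1 + F) / 2` if `ρ` is unital. -/
def halfProj (ρ : A →⋆ₙₐ[ℂ] (H →L[ℂ] H)) (F : H →L[ℂ] H) : H →L[ℂ] H :=
  (1 / 2 : ℂ) • (ρ 1 * (1 + F) * ρ 1)

/-- The operator `P ρ(u) P + (1 - P)` on `Hᵏ`, where `u` is a `k × k` matrix over `A`. -/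
def toeplitz (ρ : A →⋆ₙₐ[ℂ] (H →L[ℂ] H)) (F : H →L[ℂ] H) {k : ℕ} (u : Matrix (Fin k) (Fin k) A) :
    PiLp 2 (fun _ : Fin k => H) →L[ℂ] PiLp 2 (fun _ : Fin k => H) :=
  matOp (Matrix.of fun i j =>
    halfProj ρ F * ρ (u i j) * halfProj ρ F + if i = j then 1 - halfProj ρ F else 0)

section
variable {ρ : A →⋆ₙₐ[ℂ] (H →L[ℂ] H)} {F : H →L[ℂ] H}

theorem IsOddFredholmModule.halfProj_sq (h : IsOddFredholmModule ρ F) : IsCompactOperator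
    (halfProj ρ F * halfProj ρ F - halfProj ρ F : H →L[ℂ] H) := by
  have he : ρ 1 * ρ 1 = ρ 1 := by rw [← map_mul, one_mul]
  have h1 := (compactIdeal H).mul_mem_left (ρ 1) _ (mem_compactIdeal.2 (h.sq_sub_one 1))
  have h2 := (compactIdeal H).mul_mem_right _ (ρ 1) ((compactIdeal H).mul_mem_left
    (ρ 1 * (1 + F)) _ (mem_compactIdeal.2 (h.commutator 1)))
  rw [halfProj, halfProj_aux _ _ he]
  exact (mem_compactIdeal.1 ((compactIdeal H).sub_mem h1 h2)).smul (1 / 4 : ℂ)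

theorem IsOddFredholmModule.halfProj_comm (h : IsOddFredholmModule ρ F) (a : A) :
    IsCompactOperator
    (halfProj ρ F * ρ a - ρ a * halfProj ρ F : H →L[ℂ] H) := by
  have key : halfProj ρ F * ρ a - ρ a * halfProj ρ F = (1 / 2 : ℂ) •
      (ρ 1 * (F * ρ a - ρ a * F) - ρ a * (F * ρ 1 - ρ 1 * F)) := by
    have e1 : ρ 1 * ρ a = ρ a := by rw [← map_mul, one_mul]
    have e2 : ρ a * ρ 1 = ρ a := by rw [← map_mul, mul_one]
    have e3 : ρ 1 * (1 + F) * ρ 1 * ρ a = ρ a + ρ 1 * (F * ρ a) := by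
      rw [mul_assoc, e1, mul_add, mul_one, add_mul, mul_assoc, e1]
    have e4 : ρ a * (ρ 1 * (1 + F) * ρ 1) = ρ a + ρ a * (F * ρ 1) := by
      rw [← mul_assoc, ← mul_assoc, e2, mul_add, mul_one, add_mul, mul_assoc, e2]
    have e5 : ρ 1 * (ρ a * F) = ρ a * F := by rw [← mul_assoc, e1]
    have e6 : ρ a * (ρ 1 * F) = ρ a * F := by rw [← mul_assoc, e2]
    unfold halfProj
    rw [smul_mul_assoc, mul_smul_comm, ← smul_sub, e3, e4, mul_sub, mul_sub, e5, e6]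
    congr 1
    abel
  rw [key]
  exact (((h.commutator a).clm_comp _).sub ((h.commutator 1).clm_comp _)).smul (1 / 2 : ℂ)

theorem toeplitz_mul_sub_one (h : IsOddFredholmModule ρ F) {k : ℕ} {u v : Matrix (Fin k) (Fin k) A}
    (huv : u * v = 1) :
    IsCompactOperator (toeplitz ρ F u * toeplitz ρ F v - 1 : _ →L[ℂ] _) := by
  set p := halfProj ρ F with hp
  let q := toCalkin H
  have hep : ρ 1 * p = p := by
    rw [hp, halfProj, mul_smul_comm, ← mul_assoc, ← mul_assoc, ← map_mul, one_mul]
  have hq1 : q p * q p = q p := by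
    rw [← map_mul]; exact toCalkin_eq.2 h.halfProj_sq
  have hq2 : ∀ a, q p * q (ρ a) = q (ρ a) * q p := fun a => by
    rw [← map_mul, ← map_mul]; exact toCalkin_eq.2 (h.halfProj_comm a)
  unfold toeplitz
  rw [← matOp_mul, ← matOp_one, ← matOp_sub]
  refine matOp_isCompact fun i l => ?_
  rw [Matrix.sub_apply]
  refine toCalkin_eq.1 ?_
  have hentry : ∀ w : Matrix (Fin k) (Fin k) A,
      ((Matrix.of fun i j => p * ρ (w i j) * p + if i = j then 1 - p else 0).map q)
        = Matrix.diagonal (fun _ => q p) * (w.map fun a => q (ρ a))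
          + (1 - Matrix.diagonal (fun _ => q p)) := by
    intro w
    ext i j
    have : q (p * ρ (w i j) * p) = q p * q (ρ (w i j)) := by
      rw [map_mul, map_mul, mul_assoc, ← hq2, ← mul_assoc, hq1]
    by_cases hij : i = j
    · subst hij
      simp [this]
    · simp [this, hij]
  set P : Matrix (Fin k) (Fin k) (compactIdeal H).ringCon.Quotient :=
    Matrix.diagonal (fun _ => q p) with hP
  have hPP : P * P = P := by rw [hP, Matrix.diagonal_mul_diagonal, hq1]
  have hPU : ∀ w : Matrix (Fin k) (Fin k) A,
      P * (w.map fun a => q (ρ a)) = (w.map fun a => q (ρ a)) * P := by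
    intro w
    ext i j
    simp [hP, hq2]
  have hUV : (u.map fun a => q (ρ a)) * (v.map fun a => q (ρ a)) =
      Matrix.diagonal (fun _ => q (ρ 1)) := by
    have : (u * v).map (fun a => q (ρ a)) =
        (u.map fun a => q (ρ a)) * (v.map fun a => q (ρ a)) := by
      ext i j
      simp [Matrix.mul_apply, map_sum]
    rw [← this, huv]
    ext i j
    by_cases hij : i = j
    · subst hij; simp
    · simp [hij]
  have main : (P * (u.map fun a => q (ρ a)) + (1 - P)) *
      (P * (v.map fun a => q (ρ a)) + (1 - P)) = 1 := by
    set U := u.map fun a => q (ρ a)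
    set V := v.map fun a => q (ρ a)
    have a1 : P * U * (P * V) = P := by
      rw [hPU u, mul_assoc, ← mul_assoc P P, hPP, hPU v, ← mul_assoc, hUV, hP,
        Matrix.diagonal_mul_diagonal, ← map_mul, hep]
    have a2 : P * U * (1 - P) = 0 := by
      rw [hPU u, mul_assoc, mul_sub, mul_one, hPP, sub_self, mul_zero]
    have a3 : (1 - P) * (P * V) = 0 := by
      rw [← mul_assoc, sub_mul, one_mul, hPP, sub_self, zero_mul]
    have a4 : (1 - P) * (1 - P) = 1 - P := by
      rw [mul_sub, sub_mul, sub_mul, hPP]; simp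
    rw [add_mul, mul_add, mul_add, a1, a2, a3, a4]
    simp
  rw [← hentry u, ← hentry v, ← RingHom.mapMatrix_apply, ← RingHom.mapMatrix_apply,
    ← map_mul] at main
  have := congrFun (congrFun main i) l
  simpa [Matrix.one_apply, apply_ite] using this

/-- The operator `P ρ(u) P + (1 - P)` is Fredholm for each unitary `u`. -/
theorem toeplitz_isFredholm (h : IsOddFredholmModule ρ F) {k : ℕ}
    (u : unitary (Matrix (Fin k) (Fin k) A)) :
    (toeplitz ρ F (u : Matrix (Fin k) (Fin k) A)).IsFredholm :=
  isFredholm_of_isCompactOperator (S := toeplitz ρ F (star u : Matrix (Fin k) (Fin k) A))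
    (toeplitz_mul_sub_one h (Unitary.star_mul_self_of_mem u.2))
    (toeplitz_mul_sub_one h (Unitary.mul_star_self_of_mem u.2))

end

end FredholmModule

section KGroups

/-- A bundled odd Fredholm module over `A`. -/
structure OddFredholmModule (A : Type u) [CStarAlgebra A] : Type (max u (v + 1)) where
  H : Type v
  [normedAddCommGroup : NormedAddCommGroup H]
  [innerProductSpace : InnerProductSpace ℂ H]
  [completeSpace : CompleteSpace H]
  ρ : A →⋆ₙₐ[ℂ] (H →L[ℂ] H)
  F : H →L[ℂ] H
  isOdd : IsOddFredholmModule ρ F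

attribute [instance] OddFredholmModule.normedAddCommGroup OddFredholmModule.innerProductSpace
  OddFredholmModule.completeSpace

namespace OddFredholmModule

variable {A : Type u} [CStarAlgebra A]

/-- Unitary equivalence of Fredholm modules. -/
def UnitarilyEquivalent (M M' : OddFredholmModule.{u, v} A) : Prop :=
  ∃ e : M.H ≃ₗᵢ[ℂ] M'.H, (∀ a x, e (M.ρ a x) = M'.ρ a (e x)) ∧ ∀ x, e (M.F x) = M'.F (e x)

/-- `M` is (unitarily equivalent to) the direct sum of `M₁` and `M₂`. -/
def IsDirectSum (M M₁ M₂ : OddFredholmModule.{u, v} A) : Prop :=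
  ∃ e : WithLp 2 (M₁.H × M₂.H) ≃ₗᵢ[ℂ] M.H,
    (∀ a x y, e (WithLp.toLp 2 (M₁.ρ a x, M₂.ρ a y)) = M.ρ a (e (WithLp.toLp 2 (x, y)))) ∧
    ∀ x y, e (WithLp.toLp 2 (M₁.F x, M₂.F y)) = M.F (e (WithLp.toLp 2 (x, y)))

/-- `M` and `M'` are joined by an operator homotopy: the Hilbert space and the representation stay
fixed and the operator varies norm-continuously through Fredholm modules. -/
def OperatorHomotopic (M M' : OddFredholmModule.{u, v} A) : Prop :=
  ∃ (G : unitInterval → (M.H →L[ℂ] M.H)) (hG : ∀ t, IsOddFredholmModule M.ρ (G t)),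
    Continuous G ∧ G 0 = M.F ∧ M' = ⟨M.H, M.ρ, G 1, hG 1⟩

/-- The relations that define odd `K`-homology. -/
def relations (A : Type u) [CStarAlgebra A] :
    Set (FreeAbelianGroup (OddFredholmModule.{u, v} A)) :=
  {x | ∃ M M', (UnitarilyEquivalent M M' ∨ OperatorHomotopic M M') ∧
      x = FreeAbelianGroup.of M - FreeAbelianGroup.of M'} ∪
  {x | ∃ M M₁ M₂, IsDirectSum M M₁ M₂ ∧
      x = FreeAbelianGroup.of M - (FreeAbelianGroup.of M₁ + FreeAbelianGroup.of M₂)}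

end OddFredholmModule

/-- The odd `K`-homology group `K¹(A)`: generated by the odd Fredholm modules over `A`, with
unitarily equivalent or operator homotopic modules identified and direct sum as addition. -/
abbrev OddKHomology (A : Type u) [CStarAlgebra A] : Type (max u (v + 1)) :=
  FreeAbelianGroup (OddFredholmModule.{u, v} A) ⧸
    AddSubgroup.closure (OddFredholmModule.relations.{u, v} A)

/-- The class of a Fredholm module in `K¹(A)`. -/
def OddKHomology.mk {A : Type u} [CStarAlgebra A] (M : OddFredholmModule.{u, v} A) :
    OddKHomology.{u, v} A :=
  QuotientAddGroup.mk (FreeAbelianGroup.of M)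

/-- Unitary matrices of some size `k` over `A`. -/
abbrev UnitaryMatrices (A : Type u) [CStarAlgebra A] : Type u :=
  Σ k : ℕ, unitary (Matrix (Fin k) (Fin k) A)

/-- `w` is the block diagonal matrix `u ⊕ v`. -/
def UnitaryMatrices.IsBlockSum {A : Type u} [CStarAlgebra A] {k l : ℕ}
    (w : unitary (Matrix (Fin (k + l)) (Fin (k + l)) A)) (u : unitary (Matrix (Fin k) (Fin k) A))
    (v : unitary (Matrix (Fin l) (Fin l) A)) : Prop :=
  (w : Matrix (Fin (k + l)) (Fin (k + l)) A) = Matrix.reindex finSumFinEquiv finSumFinEquiv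
    (Matrix.fromBlocks (u : Matrix (Fin k) (Fin k) A) 0 0 (v : Matrix (Fin l) (Fin l) A))

/-- The relations that define the `K₁`-group of a unital C⋆-algebra. -/
def UnitaryMatrices.relations (A : Type u) [CStarAlgebra A] :
    Set (FreeAbelianGroup (UnitaryMatrices A)) :=
  {x | ∃ (k : ℕ) (u v : unitary (Matrix (Fin k) (Fin k) A)), Joined u v ∧
      x = FreeAbelianGroup.of (⟨k, u⟩ : UnitaryMatrices A) - FreeAbelianGroup.of ⟨k, v⟩} ∪
  {x | ∃ k : ℕ, x = FreeAbelianGroup.of (⟨k, 1⟩ : UnitaryMatrices A)} ∪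
  {x | ∃ (k l : ℕ) (w : unitary (Matrix (Fin (k + l)) (Fin (k + l)) A))
      (u : unitary (Matrix (Fin k) (Fin k) A)) (v : unitary (Matrix (Fin l) (Fin l) A)),
      UnitaryMatrices.IsBlockSum w u v ∧
      x = FreeAbelianGroup.of (⟨k + l, w⟩ : UnitaryMatrices A) -
        (FreeAbelianGroup.of ⟨k, u⟩ + FreeAbelianGroup.of ⟨l, v⟩)}

/-- The group `K₁(A)` of a unital C⋆-algebra: generated by the unitary matrices over `A`, with
homotopic ones identified, `[1] = 0` and `[u ⊕ v] = [u] + [v]`. -/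
abbrev KOne (A : Type u) [CStarAlgebra A] : Type u :=
  FreeAbelianGroup (UnitaryMatrices A) ⧸ AddSubgroup.closure (UnitaryMatrices.relations A)

/-- The class of a unitary matrix in `K₁(A)`. -/
def KOne.mk {A : Type u} [CStarAlgebra A] {k : ℕ} (u : unitary (Matrix (Fin k) (Fin k) A)) :
    KOne A :=
  QuotientAddGroup.mk (FreeAbelianGroup.of ⟨k, u⟩)

/-- A unitary element of `A`, as a `1 × 1` matrix. -/
def unitaryToMatrix {A : Type u} [CStarAlgebra A] (u : unitary A) :
    unitary (Matrix (Fin 1) (Fin 1) A) :=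
  ⟨Matrix.diagonal fun _ => (u : A), by
    rw [Unitary.mem_iff, Matrix.star_eq_conjTranspose, Matrix.diagonal_conjTranspose,
      Matrix.diagonal_mul_diagonal, Matrix.diagonal_mul_diagonal, ← Matrix.diagonal_one]
    constructor <;> congr 1 <;> funext i <;> simp⟩

variable {A : Type u} [CStarAlgebra A]

/-- The index of `P ρ(u) P + (1 - P)`, which is that of the compression `P ρ(u) P` to the range of
`P` if `P` is a projection and `ρ` is unital. -/
def toeplitzIndex (M : OddFredholmModule.{u, v} A) {k : ℕ} (u : Matrix (Fin k) (Fin k) A) : ℤ :=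
  fredholmIndex (toeplitz M.ρ M.F u).toLinearMap

theorem toeplitz_apply {H : Type*} [NormedAddCommGroup H] [InnerProductSpace ℂ H]
    [CompleteSpace H] (ρ : A →⋆ₙₐ[ℂ] (H →L[ℂ] H)) (F : H →L[ℂ] H) {k : ℕ}
    (u : Matrix (Fin k) (Fin k) A) (x : PiLp 2 (fun _ : Fin k => H)) (i : Fin k) :
    toeplitz ρ F u x i = (∑ j, halfProj ρ F (ρ (u i j) (halfProj ρ F (x j))))
      + (x i - halfProj ρ F (x i)) := by
  unfold toeplitz
  rw [matOp_apply]
  have : ∀ j, (Matrix.of (fun i j => halfProj ρ F * ρ (u i j) * halfProj ρ F +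
      if i = j then 1 - halfProj ρ F else 0) i j) (x j) =
      halfProj ρ F (ρ (u i j) (halfProj ρ F (x j))) +
        if i = j then x j - halfProj ρ F (x j) else 0 := by
    intro j
    by_cases hij : i = j
    · subst hij; simp
    · simp [hij]
  simp only [this, Finset.sum_add_distrib]
  simp

theorem halfProj_apply {H : Type*} [NormedAddCommGroup H] [InnerProductSpace ℂ H]
    [CompleteSpace H] (ρ : A →⋆ₙₐ[ℂ] (H →L[ℂ] H)) (F : H →L[ℂ] H) (x : H) :
    halfProj ρ F x = (1 / 2 : ℂ) • ρ 1 (ρ 1 x + F (ρ 1 x)) := rfl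

theorem toeplitzIndex_unitarilyEquivalent {M M' : OddFredholmModule.{u, v} A}
    (h : M.UnitarilyEquivalent M') {k : ℕ} (u : Matrix (Fin k) (Fin k) A) :
    toeplitzIndex M u = toeplitzIndex M' u := by
  obtain ⟨e, h1, h2⟩ := h
  have hp : ∀ x, e (halfProj M.ρ M.F x) = halfProj M'.ρ M'.F (e x) := by
    intro x
    simp [halfProj_apply, h1, h2]
  let E : PiLp 2 (fun _ : Fin k => M.H) ≃ₗ[ℂ] PiLp 2 (fun _ : Fin k => M'.H) :=
    ((WithLp.linearEquiv 2 ℂ (Fin k → M.H)).trans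
      (LinearEquiv.piCongrRight fun _ => e.toLinearEquiv)).trans
      (WithLp.linearEquiv 2 ℂ (Fin k → M'.H)).symm
  have hE : ∀ x i, E x i = e (x i) := fun x i => rfl
  unfold toeplitzIndex
  refine fredholmIndex_conj _ _ E E fun x => ?_
  ext i
  show E (toeplitz M.ρ M.F u x) i = toeplitz M'.ρ M'.F u (E x) i
  rw [hE, toeplitz_apply, toeplitz_apply]
  simp [hE, hp, h1]

theorem toeplitzIndex_isDirectSum {M M₁ M₂ : OddFredholmModule.{u, v} A}
    (h : OddFredholmModule.IsDirectSum M M₁ M₂) {k : ℕ} (u : unitary (Matrix (Fin k) (Fin k) A)) :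
    toeplitzIndex M u.1 = toeplitzIndex M₁ u.1 + toeplitzIndex M₂ u.1 := by
  obtain ⟨e, h1, h2⟩ := h
  have hp : ∀ x y, halfProj M.ρ M.F (e (WithLp.toLp 2 (x, y))) =
      e (WithLp.toLp 2 (halfProj M₁.ρ M₁.F x, halfProj M₂.ρ M₂.F y)) := by
    intro x y
    have hs : ∀ (c : ℂ) (x : M₁.H) (y : M₂.H),
      WithLp.toLp 2 (c • x, c • y) = c • WithLp.toLp 2 (x, y) := fun _ _ _ => rfl
    have ha : ∀ (x x' : M₁.H) (y y' : M₂.H),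
      WithLp.toLp 2 (x + x', y + y') = WithLp.toLp 2 (x, y) + WithLp.toLp 2 (x', y') :=
        fun _ _ _ _ => rfl
    rw [halfProj_apply, halfProj_apply, halfProj_apply, hs, map_smul, ← h1, ← h2, ← map_add,
      ← ha, ← h1]
  have f₁ := toeplitz_isFredholm M₁.isOdd u
  have f₂ := toeplitz_isFredholm M₂.isOdd u
  have := f₁.finite_ker
  have := f₂.finite_ker
  have : FiniteDimensional ℂ (_ ⧸ (toeplitz M₁.ρ M₁.F u.1).toLinearMap.range) :=
    f₁.finite_coker
  have : FiniteDimensional ℂ (_ ⧸ (toeplitz M₂.ρ M₂.F u.1).toLinearMap.range) :=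
    f₂.finite_coker
  unfold toeplitzIndex
  rw [← fredholmIndex_prodMap]
  let E : (PiLp 2 (fun _ : Fin k => M₁.H) × PiLp 2 (fun _ : Fin k => M₂.H)) ≃ₗ[ℂ]
      PiLp 2 (fun _ : Fin k => M.H) :=
    { toFun := fun x => WithLp.toLp 2 fun i => e (WithLp.toLp 2 (x.1 i, x.2 i))
      map_add' := fun x y => by
        ext i
        exact e.map_add (WithLp.toLp 2 (x.1 i, x.2 i)) (WithLp.toLp 2 (y.1 i, y.2 i))
      map_smul' := fun c x => by
        ext i
        exact e.toLinearEquiv.map_smul c (WithLp.toLp 2 (x.1 i, x.2 i))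
      invFun := fun y => (WithLp.toLp 2 fun i => (e.symm (y i)).fst,
        WithLp.toLp 2 fun i => (e.symm (y i)).snd)
      left_inv := fun x => by simp
      right_inv := fun y => by
        ext i
        exact e.apply_symm_apply (y i) }
  have hE : ∀ x i, E x i = e (WithLp.toLp 2 (x.1 i, x.2 i)) := fun x i => rfl
  refine (fredholmIndex_conj _ _ E E fun x => ?_).symm
  ext i
  show E (toeplitz M₁.ρ M₁.F u.1 x.1, toeplitz M₂.ρ M₂.F u.1 x.2) i =
    toeplitz M.ρ M.F u.1 (E x) i
  rw [hE, toeplitz_apply, toeplitz_apply, toeplitz_apply]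
  have hx : ∀ j, E x j = e (WithLp.toLp 2 (x.1 j, x.2 j)) := fun j => rfl
  let L : M₁.H × M₂.H →ₗ[ℂ] M.H :=
    e.toLinearEquiv.toLinearMap ∘ₗ (WithLp.linearEquiv 2 ℂ (M₁.H × M₂.H)).symm.toLinearMap
  have hL : ∀ x y, e (WithLp.toLp 2 (x, y)) = L (x, y) := fun _ _ => rfl
  have hp' : ∀ x y, halfProj M.ρ M.F (L (x, y)) =
    L (halfProj M₁.ρ M₁.F x, halfProj M₂.ρ M₂.F y) := hp
  have h1' : ∀ a x y, M.ρ a (L (x, y)) = L (M₁.ρ a x, M₂.ρ a y) := fun a x y => (h1 a x y).symm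
  have hx' : ∀ j, E x j = L (x.1 j, x.2 j) := hx
  simp only [hx', hL, hp', h1']
  rw [← map_sub L, ← map_sum L, ← map_add L]
  congr 1
  ext <;> simp [Prod.fst_sum, Prod.snd_sum]

theorem toeplitzIndex_operatorHomotopic {M M' : OddFredholmModule.{u, v} A}
    (h : M.OperatorHomotopic M') {k : ℕ} (u : unitary (Matrix (Fin k) (Fin k) A)) :
    toeplitzIndex M u.1 = toeplitzIndex M' u.1 := by
  obtain ⟨G, hG, hc, h0, rfl⟩ := h
  unfold toeplitzIndex
  rw [← h0]
  refine fredholmIndex_eq_of_path (fun t => toeplitz M.ρ (G t) u.1) ?_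
    (fun t => toeplitz_isFredholm (hG t) u) 0 1
  unfold toeplitz matOp halfProj
  simp only [Matrix.of_apply]
  refine continuous_finsetSum _ fun i _ => continuous_finsetSum _ fun j _ => ?_
  have : Continuous fun t => (if i = j then 1 - (1 / 2 : ℂ) • (M.ρ 1 * (1 + G t) * M.ρ 1) else 0) := by
    split_ifs <;> fun_prop
  fun_prop

theorem toeplitzIndex_joined (M : OddFredholmModule.{u, v} A) {k : ℕ}
    {u w : unitary (Matrix (Fin k) (Fin k) A)} (h : Joined u w) :
    toeplitzIndex M u.1 = toeplitzIndex M w.1 := by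
  obtain ⟨γ⟩ := h
  unfold toeplitzIndex
  have := fredholmIndex_eq_of_path (fun t => toeplitz M.ρ M.F (γ t).1) ?_
    (fun t => toeplitz_isFredholm M.isOdd (γ t)) 0 1
  · simpa using this
  unfold toeplitz matOp
  simp only [Matrix.of_apply]
  refine continuous_finsetSum _ fun i _ => continuous_finsetSum _ fun j _ => ?_
  have hρ : Continuous M.ρ := by
    open scoped CStarAlgebra in exact map_continuous M.ρ
  have : Continuous fun t => M.ρ ((γ t).1 i j) :=
    hρ.comp ((continuous_subtype_val.comp γ.continuous).matrix_elem i j)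
  fun_prop

theorem toeplitzIndex_one (M : OddFredholmModule.{u, v} A) (k : ℕ) :
    toeplitzIndex M (1 : Matrix (Fin k) (Fin k) A) = 0 := by
  have hK : IsCompactOperator (matOp (k := k) (Matrix.diagonal fun _ =>
      halfProj M.ρ M.F * halfProj M.ρ M.F - halfProj M.ρ M.F)) := by
    refine matOp_isCompact fun i j => ?_
    by_cases hij : i = j
    · subst hij
      simpa using M.isOdd.halfProj_sq
    · rw [Matrix.diagonal_apply_ne _ hij]
      exact isCompactOperator_zero
  have := fredholmIndex_one_add_of_isCompactOperator hK
  unfold toeplitzIndex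
  rw [← this]
  have key : toeplitz M.ρ M.F (1 : Matrix (Fin k) (Fin k) A) = 1 + matOp (k := k)
      (Matrix.diagonal fun _ => halfProj M.ρ M.F * halfProj M.ρ M.F - halfProj M.ρ M.F) := ?_
  · rw [key]
  ext x i
  have hp : ∀ y, halfProj M.ρ M.F (M.ρ 1 y) = halfProj M.ρ M.F y := by
    intro y
    have he : M.ρ 1 (M.ρ 1 y) = M.ρ 1 y := by
      have := congrArg (fun T : M.H →L[ℂ] M.H => T y) (map_mul M.ρ 1 1)
      simpa using this.symm
    simp only [halfProj_apply, he]
  have hp' : ∀ y, M.ρ 1 (halfProj M.ρ M.F y) = halfProj M.ρ M.F y := by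
    intro y
    have he : ∀ z, M.ρ 1 (M.ρ 1 z) = M.ρ 1 z := by
      intro z
      have := congrArg (fun T : M.H →L[ℂ] M.H => T z) (map_mul M.ρ 1 1)
      simpa using this.symm
    simp only [halfProj_apply, map_smul, he]
  rw [toeplitz_apply]
  have h1 : (∑ j, halfProj M.ρ M.F (M.ρ ((1 : Matrix (Fin k) (Fin k) A) i j)
      (halfProj M.ρ M.F (x j)))) = halfProj M.ρ M.F (halfProj M.ρ M.F (x i)) := by
    rw [Finset.sum_eq_single i]
    · simp [hp']
    · intro b _ hb
      simp [hb.symm]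
    · simp
  have h2 : (1 + matOp (k := k) (Matrix.diagonal fun _ =>
      halfProj M.ρ M.F * halfProj M.ρ M.F - halfProj M.ρ M.F)) x i =
      x i + (halfProj M.ρ M.F (halfProj M.ρ M.F (x i)) - halfProj M.ρ M.F (x i)) := by
    show x i + matOp _ x i = _
    rw [matOp_apply, Finset.sum_eq_single i]
    · simp
    · intro b _ hb
      simp [Matrix.diagonal_apply_ne _ hb.symm]
    · simp
  rw [h1, h2]
  abel

theorem toeplitzIndex_isBlockSum (M : OddFredholmModule.{u, v} A) {k l : ℕ}
    {w : unitary (Matrix (Fin (k + l)) (Fin (k + l)) A)}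
    {u : unitary (Matrix (Fin k) (Fin k) A)} {v : unitary (Matrix (Fin l) (Fin l) A)}
    (h : UnitaryMatrices.IsBlockSum w u v) :
    toeplitzIndex M w.1 = toeplitzIndex M u.1 + toeplitzIndex M v.1 := by
  have f₁ := toeplitz_isFredholm M.isOdd u
  have f₂ := toeplitz_isFredholm M.isOdd v
  have := f₁.finite_ker
  have := f₂.finite_ker
  have : FiniteDimensional ℂ (_ ⧸ (toeplitz M.ρ M.F u.1).toLinearMap.range) :=
    f₁.finite_coker
  have : FiniteDimensional ℂ (_ ⧸ (toeplitz M.ρ M.F v.1).toLinearMap.range) :=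
    f₂.finite_coker
  unfold toeplitzIndex
  rw [← fredholmIndex_prodMap]
  let E : PiLp 2 (fun _ : Fin (k + l) => M.H) ≃ₗ[ℂ]
      (PiLp 2 (fun _ : Fin k => M.H) × PiLp 2 (fun _ : Fin l => M.H)) :=
    { toFun := fun x => (WithLp.toLp 2 fun i => x (Fin.castAdd l i),
        WithLp.toLp 2 fun i => x (Fin.natAdd k i))
      map_add' := fun x y => rfl
      map_smul' := fun c x => rfl
      invFun := fun y => WithLp.toLp 2 (Fin.append y.1 y.2)
      left_inv := fun x => by
        ext i
        refine Fin.addCases (fun i => ?_) (fun i => ?_) i <;> simp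
      right_inv := fun y => by
        ext i <;> simp }
  refine fredholmIndex_conj _ _ E E fun x => ?_
  have hw : (w : Matrix (Fin (k + l)) (Fin (k + l)) A) = _ := h
  ext i
  · show toeplitz M.ρ M.F w.1 x (Fin.castAdd l i) = toeplitz M.ρ M.F u.1 (E x).1 i
    rw [toeplitz_apply, toeplitz_apply, Fin.sum_univ_add]
    simp [hw, E, Matrix.reindex_apply]
    rfl
  · show toeplitz M.ρ M.F w.1 x (Fin.natAdd k i) = toeplitz M.ρ M.F v.1 (E x).2 i
    rw [toeplitz_apply, toeplitz_apply, Fin.sum_univ_add]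
    simp [hw, E, Matrix.reindex_apply]
    rfl

/-- The pairing with a fixed unitary matrix, as a homomorphism on `K¹(A)`. -/
def pairingWith {k : ℕ} (u : unitary (Matrix (Fin k) (Fin k) A)) :
    OddKHomology.{u, v} A →+ ℤ :=
  QuotientAddGroup.lift _ (FreeAbelianGroup.lift fun M => toeplitzIndex M u.1) <| by
    rw [AddSubgroup.closure_le]
    rintro x (⟨M, M', h | h, rfl⟩ | ⟨M, M₁, M₂, h, rfl⟩)
    · simp [toeplitzIndex_unitarilyEquivalent h]
    · simp [toeplitzIndex_operatorHomotopic h]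
    · simp [toeplitzIndex_isDirectSum h]

/-- The index pairing `K₁(A) × K¹(A) → ℤ`: the class of a unitary `u ∈ M_k(A)` and that of a
Fredholm module `(H, ρ, F)` are paired to the Fredholm index of `P ρ(u) P` on `P Hᵏ` where
`P = (1 + F) / 2`, or more precisely to that of `P ρ(u) P + (1 - P)` on `Hᵏ`. -/
def indexPairing (A : Type u) [CStarAlgebra A] : KOne A →+ OddKHomology.{u, v} A →+ ℤ :=
  QuotientAddGroup.lift _ (FreeAbelianGroup.lift fun u => pairingWith.{u, v} u.2) <| by
    rw [AddSubgroup.closure_le]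
    rintro x ((⟨k, u, w, h, rfl⟩ | ⟨k, rfl⟩) | ⟨k, l, w, u, v, h, rfl⟩) <;>
    refine AddMonoidHom.mem_ker.2
      (QuotientAddGroup.addMonoidHom_ext _ (FreeAbelianGroup.lift_ext _ _ fun M => ?_))
    · simp [pairingWith, toeplitzIndex_joined M h]
    · simp [pairingWith, toeplitzIndex_one M k]
    · simp [pairingWith, toeplitzIndex_isBlockSum M h]

theorem indexPairing_mk {k : ℕ} (u : unitary (Matrix (Fin k) (Fin k) A))
    (M : OddFredholmModule.{u, v} A) :
    indexPairing.{u, v} A (KOne.mk u) (OddKHomology.mk M) = toeplitzIndex M u.1 := by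
  simp [indexPairing, KOne.mk, OddKHomology.mk, pairingWith]

end KGroups

section Schatten

variable {H : Type*} [NormedAddCommGroup H] [InnerProductSpace ℂ H] [CompleteSpace H]

/-- The `n`-th singular value of `T` (`n = 0, 1, 2, …`): its distance to the operators of rank at
most `n`. -/
def singularValue (T : H →L[ℂ] H) (n : ℕ) : ℝ :=
  Metric.infDist T {R : H →L[ℂ] H | (R : H →ₗ[ℂ] H).rank ≤ n}

/-- Membership in the Schatten class `L^p(H)`, `p > 0`. -/
def IsSchatten (p : ℝ) (T : H →L[ℂ] H) : Prop :=
  Summable fun n => singularValue T n ^ p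

/-- The Fredholm module `(H, ρ, F)` is `p`-summable on the dense subalgebra `𝒜`. -/
structure IsSummableOn {A : Type*} [CStarAlgebra A] (ρ : A →⋆ₙₐ[ℂ] (H →L[ℂ] H)) (F : H →L[ℂ] H)
    (p : ℝ) (𝒜 : Subalgebra ℂ A) : Prop where
  dense : Dense (𝒜 : Set A)
  sq_sub_one : ∀ a ∈ 𝒜, IsSchatten (p / 2) (ρ a * (F * F - 1) : H →L[ℂ] H)
  sub_star : ∀ a ∈ 𝒜, IsSchatten (p / 2) (ρ a * (F - star F) : H →L[ℂ] H)
  commutator : ∀ a ∈ 𝒜, IsSchatten p (F * ρ a - ρ a * F : H →L[ℂ] H)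

end Schatten

section CrossedProduct

open scoped ENNReal

instance lpInfty.cstarAlgebra {I : Type*} {B : I → Type*} [∀ i, Nontrivial (B i)]
    [∀ i, CStarAlgebra (B i)] : CStarAlgebra (lp B ∞) where

/-- A nonzero covariant representation of `(A, α)`, that is, a unital representation `π` of `A` and
a unitary `U` on a Hilbert space with `U π(a) U* = π(α(a))`. -/
structure CovRep (A : Type u) [CStarAlgebra A] (α : A ≃⋆ₐ[ℂ] A) : Type (u + 1) where
  H : Type u
  [normedAddCommGroup : NormedAddCommGroup H]
  [innerProductSpace : InnerProductSpace ℂ H]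
  [completeSpace : CompleteSpace H]
  [nontrivial : Nontrivial H]
  π : A →⋆ₐ[ℂ] (H →L[ℂ] H)
  U : unitary (H →L[ℂ] H)
  cov : ∀ a, (U : H →L[ℂ] H) * π a * star (U : H →L[ℂ] H) = π (α a)

attribute [instance] CovRep.normedAddCommGroup CovRep.innerProductSpace CovRep.completeSpace
  CovRep.nontrivial

variable {A : Type u} [CStarAlgebra A] {α : A ≃⋆ₐ[ℂ] A}

/-- The bounded families of operators, indexed by all covariant representations. -/
abbrev CovRep.Family (A : Type u) [CStarAlgebra A] (α : A ≃⋆ₐ[ℂ] A) : Type (u + 1) :=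
  lp (fun i : CovRep A α => i.H →L[ℂ] i.H) ∞

/-- The direct sum of all covariant representations, on `A`. -/
def CovRep.universalRep (A : Type u) [CStarAlgebra A] (α : A ≃⋆ₐ[ℂ] A) :
    A →⋆ₐ[ℂ] CovRep.Family A α where
  toFun a := ⟨fun i => i.π a, memℓp_infty ⟨‖a‖, by
    rintro _ ⟨i, rfl⟩; exact NonUnitalStarAlgHom.norm_apply_le i.π a⟩⟩
  map_one' := by ext i : 2; exact map_one i.π
  map_mul' a b := by ext i : 2; exact map_mul i.π a b
  map_zero' := by ext i : 2; exact map_zero i.π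
  map_add' a b := by ext i : 2; exact map_add i.π a b
  commutes' c := by ext i : 2; exact AlgHomClass.commutes i.π c
  map_star' a := by ext i : 2; exact map_star i.π a

/-- The direct sum of the unitaries of all covariant representations. -/
def CovRep.universalUnitary (A : Type u) [CStarAlgebra A] (α : A ≃⋆ₐ[ℂ] A) :
    unitary (CovRep.Family A α) :=
  ⟨⟨fun i => (i.U : i.H →L[ℂ] i.H), memℓp_infty ⟨1, by
    rintro _ ⟨i, rfl⟩; exact CStarRing.norm_of_mem_unitary i.U.2 |>.le⟩⟩, by
    rw [Unitary.mem_iff]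
    constructor
    · ext i : 2; exact Unitary.star_mul_self_of_mem i.U.2
    · ext i : 2; exact Unitary.mul_star_self_of_mem i.U.2⟩

/-- The crossed product as a subalgebra of `CovRep.Family A α`. -/
def crossedProductSubalgebra (A : Type u) [CStarAlgebra A] (α : A ≃⋆ₐ[ℂ] A) :
    StarSubalgebra ℂ (CovRep.Family A α) :=
  (StarAlgebra.adjoin ℂ (Set.range (CovRep.universalRep A α) ∪
    {(CovRep.universalUnitary A α : CovRep.Family A α)})).topologicalClosure

/-- The (full) crossed product `A ⋊_α ℤ`: the C⋆-algebra generated by a copy of `A` and a unitary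
`u` in the universal covariant representation. -/
def CrossedProduct (A : Type u) [CStarAlgebra A] (α : A ≃⋆ₐ[ℂ] A) : Type (u + 1) :=
  crossedProductSubalgebra A α

instance : CStarAlgebra (CrossedProduct A α) :=
  StarSubalgebra.cstarAlgebra (crossedProductSubalgebra A α)
    (h_closed := StarSubalgebra.isClosed_topologicalClosure _)

namespace CrossedProduct

/-- The inclusion `A → A ⋊_α ℤ`. -/
def ofBase (α : A ≃⋆ₐ[ℂ] A) : A →⋆ₐ[ℂ] CrossedProduct A α :=
  StarAlgHom.codRestrict (CovRep.universalRep A α) (crossedProductSubalgebra A α) fun a =>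
    StarSubalgebra.le_topologicalClosure _ (StarAlgebra.subset_adjoin ℂ _ (Or.inl ⟨a, rfl⟩))

/-- The unitary `u ∈ A ⋊_α ℤ` that implements `α`. -/
def implementer (α : A ≃⋆ₐ[ℂ] A) : unitary (CrossedProduct A α) :=
  ⟨⟨(CovRep.universalUnitary A α : CovRep.Family A α),
    StarSubalgebra.le_topologicalClosure _ (StarAlgebra.subset_adjoin ℂ _ (Or.inr rfl))⟩,
    Unitary.mem_iff.2
      ⟨Subtype.ext (Unitary.star_mul_self_of_mem (CovRep.universalUnitary A α).2),
        Subtype.ext (Unitary.mul_star_self_of_mem (CovRep.universalUnitary A α).2)⟩⟩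

theorem implementer_mul_ofBase_mul_star (a : A) :
    (implementer α : CrossedProduct A α) * ofBase α a * star (implementer α : CrossedProduct A α) =
      ofBase α (α a) := by
  refine Subtype.ext ?_
  ext i : 2
  exact i.cov a

theorem implementer_mul_ofBase (a : A) :
    (implementer α : CrossedProduct A α) * ofBase α a =
      ofBase α (α a) * (implementer α : CrossedProduct A α) := by
  rw [← implementer_mul_ofBase_mul_star, mul_assoc, Unitary.star_mul_self_of_mem (implementer α).2,
    mul_one]

/-- Evaluation at one covariant representation. -/
def evalRep (i : CovRep A α) : CrossedProduct A α →⋆ₐ[ℂ] (i.H →L[ℂ] i.H) where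
  toFun x := (x.1 : ∀ i : CovRep A α, i.H →L[ℂ] i.H) i
  map_one' := rfl
  map_mul' _ _ := rfl
  map_zero' := rfl
  map_add' _ _ := rfl
  commutes' _ := rfl
  map_star' _ := rfl

variable {H : Type u} [NormedAddCommGroup H] [InnerProductSpace ℂ H] [CompleteSpace H]

/-- The zero representation on the zero space, which is unital. -/
def zeroRep {B : Type*} [CStarAlgebra B] (h : Subsingleton H) : B →⋆ₐ[ℂ] (H →L[ℂ] H) where
  toFun _ := 0
  map_one' := by ext x; exact Subsingleton.elim _ _
  map_mul' _ _ := by simp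
  map_zero' := rfl
  map_add' _ _ := by simp
  commutes' _ := by ext x; exact Subsingleton.elim _ _
  map_star' _ := by simp

open Classical in
/-- The integrated form of a covariant representation `(π, U)` on `H`. -/
def integrated (π : A →⋆ₐ[ℂ] (H →L[ℂ] H)) (U : unitary (H →L[ℂ] H))
    (cov : ∀ a, (U : H →L[ℂ] H) * π a * star (U : H →L[ℂ] H) = π (α a)) :
    CrossedProduct A α →⋆ₐ[ℂ] (H →L[ℂ] H) :=
  if h : Nontrivial H then evalRep { H := H, π := π, U := U, cov := cov }
  else zeroRep (not_nontrivial_iff_subsingleton.1 h)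

theorem integrated_ofBase (π : A →⋆ₐ[ℂ] (H →L[ℂ] H)) (U : unitary (H →L[ℂ] H))
    (cov : ∀ a, (U : H →L[ℂ] H) * π a * star (U : H →L[ℂ] H) = π (α a)) (a : A) :
    integrated π U cov (ofBase α a) = π a := by
  unfold integrated
  split_ifs with h
  · rfl
  · have := not_nontrivial_iff_subsingleton.1 h
    ext x; exact Subsingleton.elim _ _

theorem integrated_implementer (π : A →⋆ₐ[ℂ] (H →L[ℂ] H)) (U : unitary (H →L[ℂ] H))
    (cov : ∀ a, (U : H →L[ℂ] H) * π a * star (U : H →L[ℂ] H) = π (α a)) :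
    integrated π U cov (implementer α : CrossedProduct A α) = U := by
  unfold integrated
  split_ifs with h
  · rfl
  · have := not_nontrivial_iff_subsingleton.1 h
    ext x; exact Subsingleton.elim _ _

/-- The monomial `a uᵏ`, `k ∈ ℤ`. -/
def monomial (α : A ≃⋆ₐ[ℂ] A) (a : A) (k : ℤ) : CrossedProduct A α :=
  ofBase α a * ((implementer α ^ k : unitary (CrossedProduct A α)) : CrossedProduct A α)

theorem implementer_zpow_mul_ofBase (a : A) (k : ℤ) :
    ((implementer α ^ k : unitary (CrossedProduct A α)) : CrossedProduct A α) * ofBase α a =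
      monomial α ((α ^ k) a) k := by
  have hn : ∀ (n : ℕ) (a : A),
      ((implementer α ^ n : unitary (CrossedProduct A α)) : CrossedProduct A α) * ofBase α a =
        ofBase α ((α ^ n) a) *
          ((implementer α ^ n : unitary (CrossedProduct A α)) : CrossedProduct A α) := by
    intro n
    induction n with
    | zero => intro a; simp
    | succ n ih =>
      intro a
      have : (α ^ (n + 1)) a = (α ^ n) (α a) := by rw [pow_succ]; rfl
      rw [this, pow_succ, Submonoid.coe_mul, mul_assoc, implementer_mul_ofBase, ← mul_assoc, ih,
        mul_assoc]
  unfold monomial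
  obtain ⟨n, rfl | rfl⟩ := k.eq_nat_or_neg
  · simpa using hn n a
  · have h := hn n ((α ^ (-(n : ℤ))) a)
    have e : (α ^ n) ((α ^ (-(n : ℤ))) a) = a := by
      rw [zpow_neg, zpow_natCast]
      exact congrArg (fun f : A ≃⋆ₐ[ℂ] A => f a) (mul_inv_cancel (α ^ n))
    rw [e] at h
    have hu := Unitary.star_mul_self_of_mem (implementer α ^ n).2
    have hu' := Unitary.mul_star_self_of_mem (implementer α ^ n).2
    rw [zpow_neg, zpow_natCast, ← Unitary.star_eq_inv, Unitary.coe_star]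
    calc _ = star ((implementer α ^ n : unitary (CrossedProduct A α)) : CrossedProduct A α) *
          (ofBase α a * ((implementer α ^ n : unitary (CrossedProduct A α)) : CrossedProduct A α)) *
          star ((implementer α ^ n : unitary (CrossedProduct A α)) : CrossedProduct A α) := by
            rw [mul_assoc, mul_assoc (ofBase α a), hu', mul_one]
      _ = _ := by rw [← h, ← mul_assoc, hu, one_mul]

theorem monomial_mul_monomial (a b : A) (k l : ℤ) :
    monomial α a k * monomial α b l = monomial α (a * (α ^ k) b) (k + l) := by
  rw [monomial, monomial, mul_assoc, ← mul_assoc _ (ofBase α b), implementer_zpow_mul_ofBase,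
    monomial, monomial, map_mul, zpow_add, Submonoid.coe_mul]
  simp only [mul_assoc]

/-- The subalgebra `C_c(ℤ, A)` of the finite sums `∑ aₖ uᵏ`. -/
def finiteSums (α : A ≃⋆ₐ[ℂ] A) : Subalgebra ℂ (CrossedProduct A α) :=
  (Submodule.span ℂ {x | ∃ a k, x = monomial α a k}).toSubalgebra
    (Submodule.subset_span ⟨1, 0, by simp [monomial]⟩) <| by
    intro x y hx hy
    induction hx, hy using Submodule.span_induction₂ with
    | mem_mem x y hx hy =>
      obtain ⟨a, k, rfl⟩ := hx
      obtain ⟨b, l, rfl⟩ := hy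
      exact Submodule.subset_span ⟨_, _, monomial_mul_monomial a b k l⟩
    | zero_left y hy => simp
    | zero_right x hx => simp
    | add_left x y z _ _ _ h1 h2 => rw [add_mul]; exact add_mem h1 h2
    | add_right x y z _ _ _ h1 h2 => rw [mul_add]; exact add_mem h1 h2
    | smul_left c x y _ _ h => rw [smul_mul_assoc]; exact Submodule.smul_mem _ _ h
    | smul_right c x y _ _ h => rw [mul_smul_comm]; exact Submodule.smul_mem _ _ h

end CrossedProduct

end CrossedProduct

section Hat

open scoped ENNReal

/-- The space `ℓ²(ι) ⊗ H`, realized as the square summable families in `H`. -/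
abbrev EllTwo (ι : Type*) (H : Type*) [NormedAddCommGroup H] : Type _ := lp (fun _ : ι => H) 2

variable {ι : Type*} {H : Type*} [NormedAddCommGroup H] [InnerProductSpace ℂ H]

/-- The block diagonal operator with blocks `T i`. -/
def diagOp (T : ι → H →L[ℂ] H) {C : ℝ} (hC : 0 ≤ C) (hT : ∀ i, ‖T i‖ ≤ C) :
    EllTwo ι H →L[ℂ] EllTwo ι H :=
  have h2 : 0 < (2 : ℝ≥0∞).toReal := by norm_num
  have key : ∀ (x : EllTwo ι H) (s : Finset ι), ∑ i ∈ s, ‖T i (x i)‖ ^ (2 : ℝ≥0∞).toReal ≤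
      (C * ‖x‖) ^ (2 : ℝ≥0∞).toReal := fun x s => by
    rw [Real.mul_rpow hC (norm_nonneg _)]
    calc ∑ i ∈ s, ‖T i (x i)‖ ^ (2 : ℝ≥0∞).toReal
        ≤ ∑ i ∈ s, C ^ (2 : ℝ≥0∞).toReal * ‖x i‖ ^ (2 : ℝ≥0∞).toReal := by
          refine Finset.sum_le_sum fun i _ => ?_
          rw [← Real.mul_rpow hC (norm_nonneg _)]
          exact Real.rpow_le_rpow (norm_nonneg _) ((T i).le_of_opNorm_le (hT i) _) h2.le
      _ ≤ _ := by
          rw [← Finset.mul_sum]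
          exact mul_le_mul_of_nonneg_left (lp.sum_rpow_le_norm_rpow h2 x s) (by positivity)
  LinearMap.mkContinuous
    { toFun := fun x => ⟨fun i => T i (x i), memℓp_gen' (key x)⟩
      map_add' := fun x y => by ext i; exact map_add (T i) (x i) (y i)
      map_smul' := fun c x => by ext i; exact map_smul (T i) c (x i) } C fun x =>
    lp.norm_le_of_forall_sum_le h2 (by positivity) (key x)

theorem diagOp_apply (T : ι → H →L[ℂ] H) {C : ℝ} (hC : 0 ≤ C) (hT : ∀ i, ‖T i‖ ≤ C)
    (x : EllTwo ι H) (i : ι) : diagOp T hC hT x i = T i (x i) := rfl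

variable [CompleteSpace H] {A : Type*} [CStarAlgebra A]

/-- The direct sum of the representations `π i`, all on the same space `H`. -/
def diagRep (π : ι → A →⋆ₐ[ℂ] (H →L[ℂ] H)) : A →⋆ₐ[ℂ] (EllTwo ι H →L[ℂ] EllTwo ι H) where
  toFun a := diagOp (fun i => π i a) (norm_nonneg a) fun i => NonUnitalStarAlgHom.norm_apply_le (π i) a
  map_one' := by ext x i; simp [diagOp_apply]
  map_mul' a b := by ext x i; simp [diagOp_apply]
  map_zero' := by ext x i; simp [diagOp_apply]
  map_add' a b := by ext x i; simp [diagOp_apply]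
  commutes' c := by ext x i; simp [diagOp_apply, Algebra.algebraMap_eq_smul_one]
  map_star' a := by
    rw [ContinuousLinearMap.star_eq_adjoint, ContinuousLinearMap.eq_adjoint_iff]
    intro x y
    rw [lp.inner_eq_tsum, lp.inner_eq_tsum]
    refine tsum_congr fun i => ?_
    rw [diagOp_apply, diagOp_apply, map_star, ContinuousLinearMap.star_eq_adjoint,
      ContinuousLinearMap.adjoint_inner_left]

theorem diagRep_apply (π : ι → A →⋆ₐ[ℂ] (H →L[ℂ] H)) (a : A) (x : EllTwo ι H) (i : ι) :
    diagRep π a x i = π i a (x i) := rfl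

/-- The unitary operator `e_m ⊗ ξ ↦ e_{m + 1} ⊗ ξ` on `ℓ²(ℤ) ⊗ H`, as an isometric
isomorphism. -/
def shiftIso (H : Type*) [NormedAddCommGroup H] [InnerProductSpace ℂ H] :
    EllTwo ℤ H ≃ₗᵢ[ℂ] EllTwo ℤ H :=
  have h2 : 0 < (2 : ℝ≥0∞).toReal := by norm_num
  have mem : ∀ (x : EllTwo ℤ H) (k : ℤ), Memℓp (fun m => x (m - k)) 2 := fun x k =>
    memℓp_gen ((Equiv.subRight k).summable_iff.2 ((lp.memℓp x).summable h2))
  { toFun := fun x => ⟨fun m => x (m - 1), mem x 1⟩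
    map_add' := fun x y => rfl
    map_smul' := fun c x => rfl
    invFun := fun x => ⟨fun m => x (m - (-1)), mem x (-1)⟩
    left_inv := fun x => by
      ext m
      exact congrArg x (show m - (-1) - 1 = m by ring)
    right_inv := fun x => by
      ext m
      exact congrArg x (show m - 1 - (-1) = m by ring)
    norm_map' := fun x => by
      rw [lp.norm_eq_tsum_rpow h2, lp.norm_eq_tsum_rpow h2]
      congr 1
      exact (Equiv.subRight (1 : ℤ)).tsum_eq fun m => ‖x m‖ ^ (2 : ℝ≥0∞).toReal }

/-- The shift as a unitary element of `B(ℓ²(ℤ) ⊗ H)`. -/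
def shiftUnitary (H : Type*) [NormedAddCommGroup H] [InnerProductSpace ℂ H] [CompleteSpace H] :
    unitary (EllTwo ℤ H →L[ℂ] EllTwo ℤ H) :=
  Unitary.linearIsometryEquiv.symm (shiftIso H)

theorem shiftUnitary_apply (x : EllTwo ℤ H) (m : ℤ) :
    (shiftUnitary H : EllTwo ℤ H →L[ℂ] EllTwo ℤ H) x m = x (m - 1) := rfl

/-- The representation `a (e_m ⊗ ξ) = e_m ⊗ π(α⁻ᵐ(a)) ξ` of `A` on `ℓ²(ℤ) ⊗ H`. -/
def hatBase (α : A ≃⋆ₐ[ℂ] A) (π : A →⋆ₐ[ℂ] (H →L[ℂ] H)) :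
    A →⋆ₐ[ℂ] (EllTwo ℤ H →L[ℂ] EllTwo ℤ H) :=
  diagRep fun m : ℤ => π.comp ((α ^ (-m) : A ≃⋆ₐ[ℂ] A) : A →⋆ₐ[ℂ] A)

theorem hatBase_apply (α : A ≃⋆ₐ[ℂ] A) (π : A →⋆ₐ[ℂ] (H →L[ℂ] H)) (a : A) (x : EllTwo ℤ H)
    (m : ℤ) : hatBase α π a x m = π ((α ^ (-m)) a) (x m) := rfl

theorem hatBase_cov (α : A ≃⋆ₐ[ℂ] A) (π : A →⋆ₐ[ℂ] (H →L[ℂ] H)) (a : A) :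
    (shiftUnitary H : EllTwo ℤ H →L[ℂ] EllTwo ℤ H) * hatBase α π a *
      star (shiftUnitary H : EllTwo ℤ H →L[ℂ] EllTwo ℤ H) = hatBase α π (α a) := by
  have h : (shiftUnitary H : EllTwo ℤ H →L[ℂ] EllTwo ℤ H) * hatBase α π a =
      hatBase α π (α a) * (shiftUnitary H : EllTwo ℤ H →L[ℂ] EllTwo ℤ H) := by
    ext x m
    have e : (α ^ (-m)) (α a) = (α ^ (-(m - 1))) a := by
      have : α ^ (-(m - 1)) = α ^ (-m) * α := by rw [← zpow_add_one]; congr 1; ring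
      rw [this]; rfl
    show hatBase α π a x (m - 1) = π ((α ^ (-m)) (α a)) (x (m - 1))
    rw [hatBase_apply, e]
  rw [h, mul_assoc, Unitary.mul_star_self_of_mem (shiftUnitary H).2, mul_one]

/-- The representation `π̂` of `A ⋊_α ℤ` on `ℓ²(ℤ) ⊗ H`:
`π̂(a) (e_m ⊗ ξ) = e_m ⊗ π(α⁻ᵐ(a)) ξ` and `π̂(u) (e_m ⊗ ξ) = e_{m + 1} ⊗ ξ`. -/
def hatRep {A H : Type u} [CStarAlgebra A] [NormedAddCommGroup H] [InnerProductSpace ℂ H]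
    [CompleteSpace H] (α : A ≃⋆ₐ[ℂ] A) (π : A →⋆ₐ[ℂ] (H →L[ℂ] H)) :
    CrossedProduct A α →⋆ₐ[ℂ] (EllTwo ℤ H →L[ℂ] EllTwo ℤ H) :=
  CrossedProduct.integrated (hatBase α π) (shiftUnitary H) (hatBase_cov α π)

theorem hatRep_ofBase {A H : Type u} [CStarAlgebra A] [NormedAddCommGroup H]
    [InnerProductSpace ℂ H] [CompleteSpace H] (α : A ≃⋆ₐ[ℂ] A) (π : A →⋆ₐ[ℂ] (H →L[ℂ] H))
    (a : A) (m : ℤ) (ξ : H) :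
    hatRep α π (CrossedProduct.ofBase α a) (lp.single 2 m ξ) =
      lp.single 2 m (π ((α ^ (-m)) a) ξ) := by
  rw [hatRep, CrossedProduct.integrated_ofBase]
  ext k
  rw [hatBase_apply]
  by_cases hk : k = m
  · subst hk; simp
  · simp [hk]

theorem hatRep_implementer {A H : Type u} [CStarAlgebra A] [NormedAddCommGroup H]
    [InnerProductSpace ℂ H] [CompleteSpace H] (α : A ≃⋆ₐ[ℂ] A) (π : A →⋆ₐ[ℂ] (H →L[ℂ] H))
    (m : ℤ) (ξ : H) :
    hatRep α π (CrossedProduct.implementer α : CrossedProduct A α) (lp.single 2 m ξ) =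
      lp.single 2 (m + 1) ξ := by
  rw [hatRep, CrossedProduct.integrated_implementer]
  ext k
  rw [shiftUnitary_apply]
  by_cases hk : k = m + 1
  · subst hk; simp
  · have : k - 1 ≠ m := fun h => hk (by omega)
    simp [hk, this]

/-- The closed span of the vectors `e_m ⊗ δ_n` with `m ∈ S` and `n ∈ N`. -/
def halfSpace {J : Type*} (δ : J → H) (S : Set ℤ) (N : Finset J) : Submodule ℂ (EllTwo ℤ H) :=
  (Submodule.span ℂ {x | ∃ m ∈ S, ∃ n ∈ N, x = lp.single 2 m (δ n)}).topologicalClosure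

/-- The operator `2 P - 1`, where `P` is the orthogonal projection onto the closed span of the
vectors `e_m ⊗ δ_n` with `m ∈ S` and `n ∈ N`. -/
def cycleOp {J : Type*} (δ : J → H) (S : Set ℤ) (N : Finset J) :
    EllTwo ℤ H →L[ℂ] EllTwo ℤ H :=
  have : CompleteSpace (halfSpace δ S N) :=
    (Submodule.isClosed_topologicalClosure _).completeSpace_coe
  2 • (halfSpace δ S N).starProjection - 1

end Hat

section Dynamics

/-- The automorphism `f ↦ f ∘ φ⁻¹` of `C(X)` that a homeomorphism `φ` of `X` induces. -/
def inducedAut {X : Type*} [TopologicalSpace X] (φ : X ≃ₜ X) : C(X, ℂ) ≃⋆ₐ[ℂ] C(X, ℂ) :=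
  φ.symm.compStarAlgEquiv' ℂ ℂ

theorem inducedAut_apply {X : Type*} [TopologicalSpace X] (φ : X ≃ₜ X) (f : C(X, ℂ)) (x : X) :
    inducedAut φ f x = f (φ.symm x) := rfl

/-- The representation `f ↦ f(x)` of `C(X)` by scalars. -/
def evalPoint {X : Type*} [TopologicalSpace X] [CompactSpace X] (x : X) :
    C(X, ℂ) →⋆ₐ[ℂ] (ℂ →L[ℂ] ℂ) where
  toFun f := f x • (1 : ℂ →L[ℂ] ℂ)
  map_one' := by simp
  map_mul' f g := by ext; simp [mul_comm]
  map_zero' := by ext; simp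
  map_add' f g := by ext; simp
  commutes' c := by simp [Algebra.algebraMap_eq_smul_one]
  map_star' f := by simp

/-- The representation `(π_τ(f) ξ)(ν) = f(τ(ν)) ξ(ν)` of `C(X)` on `ℓ²(Y)`. -/
def piTau {X Y : Type*} [TopologicalSpace X] [CompactSpace X] (τ : Y → X) :
    C(X, ℂ) →⋆ₐ[ℂ] (EllTwo Y ℂ →L[ℂ] EllTwo Y ℂ) :=
  diagRep fun ν => evalPoint (τ ν)

theorem piTau_apply {X Y : Type*} [TopologicalSpace X] [CompactSpace X] (τ : Y → X) (f : C(X, ℂ))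
    (ξ : EllTwo Y ℂ) (ν : Y) : piTau τ f ξ ν = f (τ ν) * ξ ν := rfl

open Classical in
/-- The standard basis vector `δ_ν` of `ℓ²(Y)`. -/
def deltaVec {Y : Type*} (ν : Y) : EllTwo Y ℂ := lp.single 2 ν 1

/-- The cylinder set `C_μ` of a word `μ` in `Ω^ℕ`: the sequences that begin with `μ`. -/
def cylinderNat {Ω : Type*} (μ : List Ω) : Set (ℕ → Ω) :=
  {x | ∀ (i : ℕ) (h : i < μ.length), x i = μ[i]}

/-- The cylinder set `C_μ` of a word `μ` in `Ω^ℤ`: the sequences in which `μ` is the word that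
starts at position `-⌊(|μ| - 1) / 2⌋`, so that `μ` is centred at `0` if its length is odd. -/
def cylinderInt {Ω : Type*} (μ : List Ω) : Set (ℤ → Ω) :=
  {x | ∀ (i : ℕ) (h : i < μ.length), x ((i : ℤ) - ((μ.length : ℤ) - 1) / 2) = μ[i]}

end Dynamics

section Cycles

variable {A H : Type u} [CStarAlgebra A] [NormedAddCommGroup H] [InnerProductSpace ℂ H]
  [CompleteSpace H]

/-- The triple `(ℓ²(ℤ) ⊗ H, π̂, F)` is an odd Fredholm module over `A ⋊_α ℤ`, it is `p`-summable on
`C_c(ℤ, A)` for all `p > 0`, and its class pairs with `[u] ∈ K₁(A ⋊_α ℤ)` to the integer `z`. -/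
def IsSummableCycleWithPairing (α : A ≃⋆ₐ[ℂ] A) (π : A →⋆ₐ[ℂ] (H →L[ℂ] H))
    (F : EllTwo ℤ H →L[ℂ] EllTwo ℤ H) (z : ℤ) : Prop :=
  ∃ h : IsOddFredholmModule (hatRep α π).toNonUnitalStarAlgHom F,
    (∀ p : ℝ, 0 < p →
      IsSummableOn (hatRep α π).toNonUnitalStarAlgHom F p (CrossedProduct.finiteSums α)) ∧
    indexPairing (CrossedProduct A α) (KOne.mk (unitaryToMatrix (CrossedProduct.implementer α)))
      (OddKHomology.mk ⟨EllTwo ℤ H, (hatRep α π).toNonUnitalStarAlgHom, F, h⟩) = z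

end Cycles

end

/-! Write `F = 2P - 1`, where `P` projects onto the closed span of the `e_m ⊗ δ_n` with `m ∈ S`, `n
∈ N`. Let `p` be the finite-rank projection of `H` onto the span of the `δ_n`, `n ∈ N`. Then `P` is
block diagonal over `ℤ`: it acts as `p` in the fibres `m ∈ S` and as `0` in the others
(`halfSpaceProj_apply`). Since `F² = 1` and `F* = F`, only the commutators with `F` matter.

Each `δ_n` is an eigenvector of the whole algebra, so `p` commutes with every `π(a)` and `P`
commutes with every `π̂(a)`. The commutator of `P` with the shift lives only in the fibre where the
indicator function of `S` jumps; for a half-line there is one such fibre, and the commutator has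
finite rank (`hasFiniteRange_commutator_shift`). By the Leibniz rule, `F` has finite-rank
commutators with all of `C_c(ℤ, A)`. Finite-rank operators lie in every Schatten class, which gives
summability for all `p > 0`. Because `C_c(ℤ, A)` is dense and the compact operators are norm closed,
all commutators with the crossed product are compact.

On the range of `P`, the compression of `u` is a shift of multiplicity `|N|`. For `S = {m | c ≤ m}`
it is the unilateral shift, of index `-|N|`; for `S = {m | m ≤ c}` it is the backward shift, of
index `|N|`. Both indices follow from a one-sided inverse: the compression of `u*`, or the roles
exchanged, inverts it on one side, and the defect is the copy of `span {δ_n}` in the fibre `c`.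

The symbolic case is an instance, because `δ_μ` is an eigenvector of `π_τ(f)` with eigenvalue
`f(τ(μ))`. -/

noncomputable section

open Module

/-! ### Finite-rank operators: compactness and Schatten classes -/

section FiniteRank

variable {H : Type*} [NormedAddCommGroup H] [InnerProductSpace ℂ H]

/-- The operator factors through its range, which is finite-dimensional and hence proper, and a
bounded map into a proper space is compact. -/
theorem isCompactOperator_of_hasFiniteRange {T : H →L[ℂ] H}
    (hT : (T : H →ₗ[ℂ] H).HasFiniteRange) : IsCompactOperator T := by
  have : FiniteDimensional ℂ (LinearMap.range (T : H →ₗ[ℂ] H)) :=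
    Module.Finite.iff_fg.2 (LinearMap.hasFiniteRange_iff_range.1 hT)
  let T' : H →L[ℂ] LinearMap.range (T : H →ₗ[ℂ] H) :=
    T.codRestrict _ fun x => LinearMap.mem_range_self _ x
  have : ProperSpace (LinearMap.range (T : H →ₗ[ℂ] H)) := FiniteDimensional.proper ℂ _
  have h : IsCompactOperator T' := isCompactOperator_of_locallyCompactSpace_dom T'
  exact h.clm_comp (LinearMap.range (T : H →ₗ[ℂ] H)).subtypeL

theorem isSchatten_of_hasFiniteRange {T : H →L[ℂ] H} (hT : (T : H →ₗ[ℂ] H).HasFiniteRange)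
    {p : ℝ} (hp : 0 < p) : IsSchatten p T := by
  have hfin : FiniteDimensional ℂ (LinearMap.range (T : H →ₗ[ℂ] H)) :=
    Module.Finite.iff_fg.2 (LinearMap.hasFiniteRange_iff_range.1 hT)
  -- Once `n` reaches the rank of `T`, the operator `T` itself competes in the infimum and the
  -- singular value vanishes, so the series is a finite sum. Positivity of `p` makes `0 ^ p = 0`.
  refine summable_of_ne_finset_zero
    (s := Finset.range (finrank ℂ (LinearMap.range (T : H →ₗ[ℂ] H)))) fun n hn => ?_
  have hmem : T ∈ {R : H →L[ℂ] H | (R : H →ₗ[ℂ] H).rank ≤ n} := by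
    show Module.rank ℂ (LinearMap.range (T : H →ₗ[ℂ] H)) ≤ n
    rw [← finrank_eq_rank]
    exact_mod_cast not_lt.1 (fun h => hn (Finset.mem_range.2 h))
  rw [singularValue, Metric.infDist_zero_of_mem hmem, Real.zero_rpow hp.ne']

end FiniteRank

/-- If `S T = 1` then the index of `T` is minus the dimension of the kernel of `S`. -/
theorem fredholmIndex_of_leftInverse {E F : Type*} [AddCommGroup E] [Module ℂ E] [AddCommGroup F]
    [Module ℂ F] {T : E →ₗ[ℂ] F} {S : F →ₗ[ℂ] E} (h : ∀ x, S (T x) = x) :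
    fredholmIndex T = -(finrank ℂ (LinearMap.ker S) : ℤ) := by
  have hk : LinearMap.ker T = ⊥ := LinearMap.ker_eq_bot.2 (Function.LeftInverse.injective h)
  -- `T S` is a projection onto the range of `T`, and its kernel is that of `S` because `T` is
  -- injective. So `ker S` is a model of the cokernel of `T`.
  have hc : IsCompl (LinearMap.range T) (LinearMap.ker S) :=
    LinearMap.ker_comp_of_ker_eq_bot S (g := T.rangeRestrict)
      (by rw [LinearMap.ker_rangeRestrict, hk]) ▸
      LinearMap.isCompl_of_proj (f := T.rangeRestrict ∘ₗ S) (by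
        rintro ⟨_, x, rfl⟩
        exact Subtype.ext (congrArg T (h x)))
  rw [fredholmIndex, hk, (Submodule.quotientEquivOfIsCompl _ _ hc).finrank_eq]
  simp

/-- If `S T = 1` then the index of `S` is the dimension of its kernel. -/
theorem fredholmIndex_of_rightInverse {E F : Type*} [AddCommGroup E] [Module ℂ E]
    [AddCommGroup F] [Module ℂ F] {T : E →ₗ[ℂ] F} {S : F →ₗ[ℂ] E} (h : ∀ x, S (T x) = x) :
    fredholmIndex S = (finrank ℂ (LinearMap.ker S) : ℤ) := by
  have hr : LinearMap.range S = ⊤ := LinearMap.range_eq_top.2 fun x => ⟨T x, h x⟩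
  have : Subsingleton (E ⧸ (⊤ : Submodule ℂ E)) := Submodule.Quotient.subsingleton_iff.2 rfl
  rw [fredholmIndex, hr, finrank_zero_of_subsingleton (M := E ⧸ (⊤ : Submodule ℂ E))]
  simp

/-! ### Finite sums in the crossed product: density and commutators -/

section Density

namespace CrossedProduct

variable {A : Type u} [CStarAlgebra A] {α : A ≃⋆ₐ[ℂ] A}

theorem monomial_mem_finiteSums (a : A) (k : ℤ) : monomial α a k ∈ finiteSums α :=
  Submodule.subset_span ⟨a, k, rfl⟩

/-- The covariance relation moves the coefficient back to the left: `(a uᵏ)* = u⁻ᵏ a* = α⁻ᵏ(a*)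
u⁻ᵏ`. This makes the finite sums a star subalgebra, as needed for a comparison with
`StarAlgebra.adjoin`. -/
theorem star_mem_finiteSums {x : CrossedProduct A α} (hx : x ∈ finiteSums α) :
    star x ∈ finiteSums α := by
  replace hx : x ∈ Submodule.span ℂ {x | ∃ a k, x = monomial α a k} := hx
  induction hx using Submodule.span_induction with
  | mem x hx =>
    obtain ⟨a, k, rfl⟩ := hx
    have : star (monomial α a k) = monomial α ((α ^ (-k)) (star a)) (-k) := by
      rw [← implementer_zpow_mul_ofBase, monomial, star_mul, map_star, zpow_neg,
        ← Unitary.star_eq_inv, Unitary.coe_star]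
    rw [this]
    exact monomial_mem_finiteSums _ _
  | zero => rw [star_zero]; exact zero_mem _
  | add x y hx hy h1 h2 => rw [star_add]; exact add_mem h1 h2
  | smul c x hx h => rw [star_smul]; exact Subalgebra.smul_mem _ h _

/-- The finite sums are dense in the crossed product. -/
theorem dense_finiteSums (α : A ≃⋆ₐ[ℂ] A) : Dense (finiteSums α : Set (CrossedProduct A α)) := by
  let S : StarSubalgebra ℂ (CrossedProduct A α) :=
    { finiteSums α with star_mem' := star_mem_finiteSums }
  let ι : CrossedProduct A α →⋆ₐ[ℂ] CovRep.Family A α :=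
    { toFun := fun x => x.1
      map_one' := rfl
      map_mul' := fun _ _ => rfl
      map_zero' := rfl
      map_add' := fun _ _ => rfl
      commutes' := fun _ => rfl
      map_star' := fun _ => rfl }
  -- The image of the finite sums is a star subalgebra that contains the generators, so it contains
  -- everything whose closure defines the crossed product.
  have hle : StarAlgebra.adjoin ℂ (Set.range (CovRep.universalRep A α) ∪
      {(CovRep.universalUnitary A α : CovRep.Family A α)}) ≤
      S.map ι := by
    refine StarAlgebra.adjoin_le ?_
    rintro _ (⟨a, rfl⟩ | rfl)
    · refine ⟨ofBase α a, ?_, rfl⟩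
      have := monomial_mem_finiteSums (α := α) a 0
      rwa [monomial, zpow_zero, OneMemClass.coe_one, mul_one] at this
    · refine ⟨(implementer α : CrossedProduct A α), ?_, rfl⟩
      have := monomial_mem_finiteSums (α := α) 1 1
      rwa [monomial, zpow_one, map_one, one_mul] at this
  intro x
  have hx : x.1 ∈ closure ((S.map ι : StarSubalgebra ℂ (CovRep.Family A α)) :
      Set (CovRep.Family A α)) :=
    closure_mono hle x.2
  -- The crossed product carries the subspace topology, so density may be tested in the ambient
  -- algebra of bounded families.
  exact closure_subtype.2 hx

/-- If `F` commutes with `A` and its commutator with `u` has finite rank, then so has its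
commutator with each finite sum. -/
theorem hasFiniteRange_commutator_of_mem_finiteSums {K : Type*} [NormedAddCommGroup K]
    [InnerProductSpace ℂ K] [CompleteSpace K]
    (ρ : CrossedProduct A α →⋆ₐ[ℂ] (K →L[ℂ] K)) (F : K →L[ℂ] K)
    (hA : ∀ a, F * ρ (ofBase α a) = ρ (ofBase α a) * F)
    (hU : ((F * ρ (implementer α : CrossedProduct A α) -
      ρ (implementer α : CrossedProduct A α) * F : K →L[ℂ] K) : K →ₗ[ℂ] K).HasFiniteRange)
    {x : CrossedProduct A α} (hx : x ∈ finiteSums α) :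
    ((F * ρ x - ρ x * F : K →L[ℂ] K) : K →ₗ[ℂ] K).HasFiniteRange := by
  set P : CrossedProduct A α → Prop := fun x =>
    ((F * ρ x - ρ x * F : K →L[ℂ] K) : K →ₗ[ℂ] K).HasFiniteRange with hP
  -- The commutator with `F` is a derivation and the finite-rank operators form an ideal, so `P`
  -- passes to products.
  have hmul : ∀ x y, P x → P y → P (x * y) := by
    intro x y hx hy
    have e : F * ρ (x * y) - ρ (x * y) * F =
        (F * ρ x - ρ x * F) * ρ y + ρ x * (F * ρ y - ρ y * F) := by
      rw [map_mul]; noncomm_ring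
    show ((F * ρ (x * y) - ρ (x * y) * F : K →L[ℂ] K) : K →ₗ[ℂ] K).HasFiniteRange
    rw [e]
    exact (hx.comp_right (ρ y : K →ₗ[ℂ] K)).add (hy.comp_left (ρ x : K →ₗ[ℂ] K))
  have hbase : ∀ a, P (ofBase α a) := fun a => by
    show ((_ : K →L[ℂ] K) : K →ₗ[ℂ] K).HasFiniteRange
    rw [hA, sub_self]
    exact LinearMap.HasFiniteRange.zero
  have hone : P 1 := by simpa using hbase 1
  -- Negative powers of `u` are handled by the derivation rule for inverses, `[F, w⁻¹] = -w⁻¹ [F, w]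
  -- w⁻¹`.
  have hinv : ∀ w : unitary (CrossedProduct A α), P w →
      P ((w⁻¹ : unitary (CrossedProduct A α)) : CrossedProduct A α) := by
    intro w hw
    set v : CrossedProduct A α := ((w⁻¹ : unitary (CrossedProduct A α)) : CrossedProduct A α)
    have h1 : ρ v * ρ w = 1 := by
      rw [← map_mul, ← Submonoid.coe_mul, inv_mul_cancel, OneMemClass.coe_one, map_one]
    have h2 : ρ w * ρ v = 1 := by
      rw [← map_mul, ← Submonoid.coe_mul, mul_inv_cancel, OneMemClass.coe_one, map_one]
    have e : F * ρ v - ρ v * F = -(ρ v * ((F * ρ w - ρ w * F) * ρ v)) := by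
      have a1 : ρ v * (F * ρ w * ρ v) = ρ v * F := by
        rw [mul_assoc F, h2, mul_one]
      have a2 : ρ v * (ρ w * F * ρ v) = F * ρ v := by
        rw [mul_assoc, ← mul_assoc, h1, one_mul]
      rw [sub_mul, mul_sub, a1, a2]; abel
    show ((F * ρ v - ρ v * F : K →L[ℂ] K) : K →ₗ[ℂ] K).HasFiniteRange
    rw [e]
    exact ((hw.comp_right (ρ v : K →ₗ[ℂ] K)).comp_left (ρ v : K →ₗ[ℂ] K)).neg
  have hpow : ∀ n : ℕ, P ((implementer α ^ n : unitary (CrossedProduct A α)) :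
      CrossedProduct A α) := by
    intro n
    induction n with
    | zero => simpa using hone
    | succ n ih => rw [pow_succ, Submonoid.coe_mul]; exact hmul _ _ ih hU
  have hx' : x ∈ Submodule.span ℂ {x | ∃ a k, x = monomial α a k} := hx
  show P x
  clear hx
  induction hx' using Submodule.span_induction with
  | mem x hx =>
    obtain ⟨a, k, rfl⟩ := hx
    refine hmul _ _ (hbase a) ?_
    obtain ⟨n, rfl | rfl⟩ := k.eq_nat_or_neg
    · rw [zpow_natCast]; exact hpow n
    · rw [zpow_neg, zpow_natCast]; exact hinv _ (hpow n)
  | zero => simpa using hbase 0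
  | add x y _ _ h1 h2 =>
    have e : F * ρ (x + y) - ρ (x + y) * F = (F * ρ x - ρ x * F) + (F * ρ y - ρ y * F) := by
      rw [map_add]; noncomm_ring
    show ((F * ρ (x + y) - ρ (x + y) * F : K →L[ℂ] K) : K →ₗ[ℂ] K).HasFiniteRange
    rw [e]
    exact LinearMap.HasFiniteRange.add h1 h2
  | smul c x _ h =>
    have e : F * ρ (c • x) - ρ (c • x) * F = c • (F * ρ x - ρ x * F) := by
      rw [map_smul, mul_smul_comm, smul_mul_assoc, smul_sub]
    show ((F * ρ (c • x) - ρ (c • x) * F : K →L[ℂ] K) : K →ₗ[ℂ] K).HasFiniteRange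
    rw [e]
    exact LinearMap.HasFiniteRange.smul h c

end CrossedProduct

end Density

/-! ### From finite-rank commutators to summable Fredholm modules -/

section Assembly

variable {A K : Type*} [CStarAlgebra A] [NormedAddCommGroup K] [InnerProductSpace ℂ K]
  [CompleteSpace K]

/-- A symmetry whose commutators with a dense subalgebra are of finite rank defines an odd Fredholm
module. -/
theorem isOddFredholmModule_of_hasFiniteRange [TopologicalSpace.SeparableSpace K]
    (ρ : A →⋆ₐ[ℂ] (K →L[ℂ] K)) {F : K →L[ℂ] K} (hF : F * F = 1) (hF' : star F = F) {s : Set A}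
    (hs : Dense s)
    (hc : ∀ a ∈ s, ((F * ρ a - ρ a * F : K →L[ℂ] K) : K →ₗ[ℂ] K).HasFiniteRange) :
    IsOddFredholmModule ρ.toNonUnitalStarAlgHom F where
  separable := inferInstance
  sq_sub_one a := by
    rw [hF, sub_self, zero_mul]
    exact isCompactOperator_zero
  sub_star a := by
    rw [hF', sub_self, zero_mul]
    exact isCompactOperator_zero
  commutator a := by
    have hρ : Continuous ρ := by
      open scoped CStarAlgebra in exact map_continuous ρ.toNonUnitalStarAlgHom
    -- The commutator depends continuously on `a` and the compact operators are norm closed, so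
    -- compactness extends from the dense set `s` to the whole algebra.
    have hcl : IsClosed {a | IsCompactOperator (F * ρ a - ρ a * F : K →L[ℂ] K)} :=
      (isClosed_setOfPred_isCompactOperator (σ₁₂ := RingHom.id ℂ) (M₁ := K) (M₂ := K)).preimage
        (f := fun a => F * ρ a - ρ a * F) (by fun_prop)
    exact hcl.closure_subset_iff.2
      (fun b hb => isCompactOperator_of_hasFiniteRange (hc b hb)) (hs a)

theorem isSummableOn_of_hasFiniteRange (ρ : A →⋆ₐ[ℂ] (K →L[ℂ] K)) {F : K →L[ℂ] K}
    (hF : F * F = 1) (hF' : star F = F) {𝒜 : Subalgebra ℂ A} (hs : Dense (𝒜 : Set A))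
    (hc : ∀ a ∈ 𝒜, ((F * ρ a - ρ a * F : K →L[ℂ] K) : K →ₗ[ℂ] K).HasFiniteRange)
    {p : ℝ} (hp : 0 < p) : IsSummableOn ρ.toNonUnitalStarAlgHom F p 𝒜 where
  dense := hs
  sq_sub_one a _ := by
    rw [hF, sub_self, mul_zero]
    exact isSchatten_of_hasFiniteRange LinearMap.HasFiniteRange.zero (half_pos hp)
  sub_star a _ := by
    rw [hF', sub_self, mul_zero]
    exact isSchatten_of_hasFiniteRange LinearMap.HasFiniteRange.zero (half_pos hp)
  commutator a ha := isSchatten_of_hasFiniteRange (hc a ha) hp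

theorem matOp_one_by_one_apply (M : Matrix (Fin 1) (Fin 1) (K →L[ℂ] K))
    (x : PiLp 2 (fun _ : Fin 1 => K)) : matOp M x 0 = M 0 0 (x 0) := by
  rw [matOp_apply, Fin.sum_univ_one]

/-- For a unital representation and `F = 2 P - 1`, the index pairing with a unitary `w` of the
algebra is the index of `P ρ(w) P + (1 - P)`. -/
theorem fredholmIndex_toeplitz_unitaryToMatrix {A : Type u} [CStarAlgebra A]
    (ρ : A →⋆ₐ[ℂ] (K →L[ℂ] K)) (P : K →L[ℂ] K) (w : unitary A) :
    fredholmIndex (toeplitz ρ.toNonUnitalStarAlgHom (2 • P - 1) (unitaryToMatrix w).1).toLinearMap =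
      fredholmIndex (P * ρ w * P + (1 - P) : K →L[ℂ] K).toLinearMap := by
  have h1 : ρ.toNonUnitalStarAlgHom 1 = 1 := map_one ρ
  -- Since `ρ` is unital, the outer factors `ρ(1)` disappear and `(1 + F) / 2` is `P` itself.
  have hp : halfProj ρ.toNonUnitalStarAlgHom (2 • P - 1) = P := by
    unfold halfProj
    rw [h1, one_mul, mul_one, add_sub_cancel, two_smul]
    module
  let E : PiLp 2 (fun _ : Fin 1 => K) ≃ₗ[ℂ] K :=
    (WithLp.linearEquiv 2 ℂ (Fin 1 → K)).trans (LinearEquiv.funUnique (Fin 1) ℂ _)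
  refine fredholmIndex_conj _ _ E E fun x => ?_
  show matOp _ x 0 = (P * ρ w * P + (1 - P)) (x 0)
  rw [matOp_one_by_one_apply, Matrix.of_apply, if_pos rfl, hp]
  rfl

end Assembly

/-! ### Square summable families -/

section EllTwoSpace

open scoped ENNReal

variable {ι H : Type*} [NormedAddCommGroup H] [InnerProductSpace ℂ H]

theorem EllTwo.hasSum_single [DecidableEq ι] (x : EllTwo ι H) :
    HasSum (fun i => (lp.single 2 i (x i) : EllTwo ι H)) x :=
  lp.hasSum_single (by norm_num) x

/-- Vectors supported at `i`, as a linear map. -/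
def EllTwo.singleLinear [DecidableEq ι] (i : ι) : H →ₗ[ℂ] EllTwo ι H where
  toFun x := lp.single (E := fun _ : ι => H) 2 i x
  map_add' x y := lp.single_add (E := fun _ : ι => H) 2 i x y
  map_smul' c x := lp.single_smul (E := fun _ : ι => H) 2 i c x

theorem EllTwo.singleLinear_apply [DecidableEq ι] (i : ι) (x : H) :
    EllTwo.singleLinear i x = (lp.single 2 i x : EllTwo ι H) := rfl

theorem EllTwo.singleLinear_injective [DecidableEq ι] (i : ι) :
    Function.Injective (EllTwo.singleLinear (H := H) i) := fun x y h => by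
  have := congrArg (fun z : EllTwo ι H => z i) h
  simpa [EllTwo.singleLinear_apply] using this

/-- This locates the range of the commutator with the shift, and the kernels of the compressed
shifts, inside a single fibre. -/
theorem EllTwo.eq_singleLinear [DecidableEq ι] {i : ι} {x : EllTwo ι H}
    (h : ∀ j, j ≠ i → x j = 0) : x = EllTwo.singleLinear i (x i) := by
  ext j
  rw [EllTwo.singleLinear_apply]
  by_cases hj : j = i
  · subst hj; simp
  · simp [hj, h j hj]

/-- The vectors supported at one index form a countable union of separable sets, and every vector is
a limit of finite sums of these. -/
instance EllTwo.separableSpace [Countable ι] [TopologicalSpace.SeparableSpace H] :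
    TopologicalSpace.SeparableSpace (EllTwo ι H) := by
  classical
  have h1 : TopologicalSpace.IsSeparable
      (⋃ i : ι, Set.range (fun x : H => (lp.single 2 i x : EllTwo ι H))) :=
    TopologicalSpace.isSeparable_iUnion.2 fun i =>
      TopologicalSpace.isSeparable_range (lp.isometry_single (E := fun _ : ι => H) (p := 2) i).continuous
  refine TopologicalSpace.isSeparable_univ_iff.1 ((h1.span (R := ℂ)).closure.mono fun x _ => ?_)
  refine mem_closure_of_tendsto (EllTwo.hasSum_single x)
    (Filter.Eventually.of_forall fun s => ?_)
  exact Submodule.sum_mem _ fun i _ =>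
    Submodule.subset_span (Set.mem_iUnion.2 ⟨i, x i, rfl⟩)

theorem orthonormal_deltaVec {Y : Type*} : Orthonormal ℂ (deltaVec : Y → EllTwo Y ℂ) := by
  classical
  rw [orthonormal_iff_ite]
  intro i j
  unfold deltaVec
  rw [lp.inner_single_left]
  by_cases h : i = j
  · subst h; simp
  · simp [h]

end EllTwoSpace

/-! ### The projection onto a half-space, fibre by fibre -/

section HalfSpace

variable {H : Type*} [NormedAddCommGroup H] [InnerProductSpace ℂ H] {J : Type*}

/-- The span of the vectors `δ n` with `n ∈ N`. -/
def finSpan (δ : J → H) (N : Finset J) : Submodule ℂ H :=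
  Submodule.span ℂ (Set.range fun n : N => δ n)

instance (δ : J → H) (N : Finset J) : FiniteDimensional ℂ (finSpan δ N) :=
  FiniteDimensional.span_of_finite ℂ (Set.finite_range _)

theorem mem_finSpan (δ : J → H) {N : Finset J} {n : J} (hn : n ∈ N) : δ n ∈ finSpan δ N :=
  Submodule.subset_span ⟨⟨n, hn⟩, rfl⟩

theorem finrank_finSpan {δ : J → H} (hδ : Orthonormal ℂ δ) (N : Finset J) :
    finrank ℂ (finSpan δ N) = N.card := by
  have hli : LinearIndependent ℂ (fun n : N => δ n) :=
    hδ.linearIndependent.comp _ Subtype.val_injective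
  rw [finSpan, finrank_span_eq_card hli, Fintype.card_coe]

/-- The orthogonal projection onto the span of the vectors `δ n` with `n ∈ N`. -/
def finProj (δ : J → H) (N : Finset J) : H →L[ℂ] H := (finSpan δ N).starProjection

theorem finProj_mem (δ : J → H) (N : Finset J) (x : H) : finProj δ N x ∈ finSpan δ N :=
  Submodule.starProjection_apply_mem _ x

theorem finProj_eq_self {δ : J → H} {N : Finset J} {x : H} :
    finProj δ N x = x ↔ x ∈ finSpan δ N :=
  Submodule.starProjection_eq_self_iff

theorem finProj_idem (δ : J → H) (N : Finset J) (x : H) :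
    finProj δ N (finProj δ N x) = finProj δ N x :=
  finProj_eq_self.2 (finProj_mem δ N x)

/-- The projection onto the span of simultaneous eigenvectors commutes with a representation. -/
theorem finProj_comm [CompleteSpace H] {A : Type*} [CStarAlgebra A] (π : A →⋆ₐ[ℂ] (H →L[ℂ] H))
    {δ : J → H} (hπ : ∀ a n, ∃ c : ℂ, π a (δ n) = c • δ n) (N : Finset J) (a : A) (x : H) :
    finProj δ N (π a x) = π a (finProj δ N x) := by
  have hinv : ∀ b, ∀ y ∈ finSpan δ N, π b y ∈ finSpan δ N := by
    intro b y hy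
    have hle : finSpan δ N ≤ (finSpan δ N).comap (π b : H →ₗ[ℂ] H) := by
      refine Submodule.span_le.2 ?_
      rintro _ ⟨n, rfl⟩
      obtain ⟨c, hc⟩ := hπ b n
      show π b (δ n) ∈ finSpan δ N
      rw [hc]
      exact Submodule.smul_mem _ _ (mem_finSpan δ n.2)
    exact hle hy
  -- The span is invariant under `π(a*)` as well as `π(a)`, hence reducing: moving `π(a)` across the
  -- inner product shows that `π(a)` also preserves the orthogonal complement.
  refine Submodule.eq_starProjection_of_mem_of_inner_eq_zero (u := π a x)
    (hinv a _ (finProj_mem δ N x)) fun w hw => ?_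
  rw [← map_sub, ← ContinuousLinearMap.adjoint_inner_right, ← ContinuousLinearMap.star_eq_adjoint,
    ← map_star]
  exact Submodule.starProjection_inner_eq_zero x _ (hinv _ w hw)

/-- The orthogonal projection onto `halfSpace δ S N`. -/
def halfSpaceProj (δ : J → H) (S : Set ℤ) (N : Finset J) [CompleteSpace H] :
    EllTwo ℤ H →L[ℂ] EllTwo ℤ H :=
  have : CompleteSpace (halfSpace δ S N) :=
    (Submodule.isClosed_topologicalClosure _).completeSpace_coe
  (halfSpace δ S N).starProjection

-- The block diagonal operator `D` with these fibres is bounded, and it has the two properties that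
-- characterize the orthogonal projection: `D x` lies in the half-space and `x - D x` is orthogonal
-- to it. The later arguments work with this formula instead of the closed span.
open Classical in
theorem halfSpaceProj_apply [CompleteSpace H] (δ : J → H) (S : Set ℤ) (N : Finset J)
    (x : EllTwo ℤ H) (m : ℤ) :
    halfSpaceProj δ S N x m = if m ∈ S then finProj δ N (x m) else 0 := by
  have : CompleteSpace (halfSpace δ S N) :=
    (Submodule.isClosed_topologicalClosure _).completeSpace_coe
  have hnorm : ∀ m, ‖(if m ∈ S then finProj δ N else 0 : H →L[ℂ] H)‖ ≤ 1 := by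
    intro m
    split_ifs
    · exact Submodule.starProjection_norm_le _
    · simp
  set D : EllTwo ℤ H →L[ℂ] EllTwo ℤ H := diagOp _ zero_le_one hnorm with hD
  have hDx : ∀ m, D x m = if m ∈ S then finProj δ N (x m) else 0 := by
    intro m
    rw [hD, diagOp_apply]
    split_ifs <;> rfl
  have key : halfSpaceProj δ S N x = D x := by
    refine Submodule.eq_starProjection_of_mem_of_inner_eq_zero (K := halfSpace δ S N) ?_ ?_
    -- `D x` is the limit of the finite sums of its fibres, each of which already lies in the
    -- algebraic span.
    · refine mem_closure_of_tendsto (EllTwo.hasSum_single (D x))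
        (Filter.Eventually.of_forall fun s => Submodule.sum_mem _ fun m _ => ?_)
      rw [hDx]
      split_ifs with hm
      · have hle : finSpan δ N ≤ (Submodule.span ℂ {x : EllTwo ℤ H | ∃ m ∈ S, ∃ n ∈ N,
            x = lp.single 2 m (δ n)}).comap (EllTwo.singleLinear m) := by
          refine Submodule.span_le.2 ?_
          rintro _ ⟨n, rfl⟩
          exact Submodule.subset_span ⟨m, hm, n, n.2, rfl⟩
        exact hle (finProj_mem δ N (x m))
      · rw [lp.single_zero]
        exact zero_mem _
    · intro w hw
      -- Orthogonality to a fixed vector is a closed linear condition, so it is enough to test it on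
      -- the vectors `e_m ⊗ δ_n`.
      have hcl : halfSpace δ S N ≤ (ℂ ∙ (x - D x))ᗮ := by
        refine Submodule.topologicalClosure_minimal _ (Submodule.span_le.2 ?_)
          (Submodule.isClosed_orthogonal _)
        rintro _ ⟨m, hm, n, hn, rfl⟩
        rw [SetLike.mem_coe, Submodule.mem_orthogonal_singleton_iff_inner_right,
          lp.inner_single_right, lp.coeFn_sub, Pi.sub_apply, hDx, if_pos hm]
        exact Submodule.starProjection_inner_eq_zero (x m) _ (mem_finSpan δ hn)
      exact (Submodule.mem_orthogonal_singleton_iff_inner_right).1 (hcl hw)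
  rw [key, hDx]

variable [CompleteSpace H] (δ : J → H) (S : Set ℤ) (N : Finset J)

theorem halfSpaceProj_mul_self :
    halfSpaceProj δ S N * halfSpaceProj δ S N = halfSpaceProj δ S N := by
  have : CompleteSpace (halfSpace δ S N) :=
    (Submodule.isClosed_topologicalClosure _).completeSpace_coe
  exact Submodule.isIdempotentElem_starProjection _

theorem star_halfSpaceProj : star (halfSpaceProj δ S N) = halfSpaceProj δ S N := by
  have : CompleteSpace (halfSpace δ S N) :=
    (Submodule.isClosed_topologicalClosure _).completeSpace_coe
  exact (isSelfAdjoint_starProjection _).star_eq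

theorem cycleOp_eq : cycleOp δ S N = 2 • halfSpaceProj δ S N - 1 := rfl

theorem cycleOp_mul_self : cycleOp δ S N * cycleOp δ S N = 1 := by
  rw [cycleOp_eq, sub_mul, mul_sub, smul_mul_smul_comm, halfSpaceProj_mul_self]
  simp only [mul_one, one_mul]
  module

theorem star_cycleOp : star (cycleOp δ S N) = cycleOp δ S N := by
  rw [cycleOp_eq, star_sub, star_one, star_nsmul, star_halfSpaceProj]

theorem cycleOp_mul_sub (T : EllTwo ℤ H →L[ℂ] EllTwo ℤ H) :
    cycleOp δ S N * T - T * cycleOp δ S N =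
      (2 : ℂ) • (halfSpaceProj δ S N * T - T * halfSpaceProj δ S N) := by
  rw [cycleOp_eq, two_smul, two_smul]
  noncomm_ring

end HalfSpace

/-! ### Commutators of the projection with the algebra and with the shift -/

section Commutators

variable {H : Type*} [NormedAddCommGroup H] [InnerProductSpace ℂ H] [CompleteSpace H] {J : Type*}

/-- Both operators are block diagonal over `ℤ`. The twist by `α⁻ᵐ` only replaces `a` by another
element of the algebra, and `finProj` commutes with the image of every element. -/
theorem halfSpaceProj_comm_hatBase {A : Type*} [CStarAlgebra A] (α : A ≃⋆ₐ[ℂ] A)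
    (π : A →⋆ₐ[ℂ] (H →L[ℂ] H)) {δ : J → H} (hπ : ∀ a n, ∃ c : ℂ, π a (δ n) = c • δ n)
    (S : Set ℤ) (N : Finset J) (a : A) :
    halfSpaceProj δ S N * hatBase α π a = hatBase α π a * halfSpaceProj δ S N := by
  classical
  ext x m
  show halfSpaceProj δ S N (hatBase α π a x) m = hatBase α π a (halfSpaceProj δ S N x) m
  rw [halfSpaceProj_apply, hatBase_apply, hatBase_apply, halfSpaceProj_apply, finProj_comm π hπ]
  split_ifs
  · rfl
  · rw [map_zero]

/-- In the fibre `m` the commutator is `(1_S(m) - 1_S(m - 1)) p x(m - 1)`. By `hS` the coefficient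
can be nonzero only at `m = c`, so the range lies in the finite-dimensional space `e_c ⊗ finSpan δ
N`. -/
theorem hasFiniteRange_commutator_shift (δ : J → H) {S : Set ℤ} {c : ℤ}
    (hS : ∀ m, m ≠ c → (m ∈ S ↔ m - 1 ∈ S)) (N : Finset J) :
    ((halfSpaceProj δ S N * (shiftUnitary H : EllTwo ℤ H →L[ℂ] EllTwo ℤ H) -
      (shiftUnitary H : EllTwo ℤ H →L[ℂ] EllTwo ℤ H) * halfSpaceProj δ S N :
        EllTwo ℤ H →L[ℂ] EllTwo ℤ H) : EllTwo ℤ H →ₗ[ℂ] EllTwo ℤ H).HasFiniteRange := by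
  classical
  rw [LinearMap.hasFiniteRange_iff_range]
  refine Module.Finite.iff_fg.1 (Submodule.finiteDimensional_of_le
    (S₂ := (finSpan δ N).map (EllTwo.singleLinear c)) ?_)
  rintro _ ⟨x, rfl⟩
  have hz : ∀ m, ((halfSpaceProj δ S N * (shiftUnitary H : EllTwo ℤ H →L[ℂ] EllTwo ℤ H) -
      (shiftUnitary H : EllTwo ℤ H →L[ℂ] EllTwo ℤ H) * halfSpaceProj δ S N :
        EllTwo ℤ H →L[ℂ] EllTwo ℤ H) x) m = (if m ∈ S then finProj δ N (x (m - 1)) else 0) -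
          (if m - 1 ∈ S then finProj δ N (x (m - 1)) else 0) := by
    intro m
    show halfSpaceProj δ S N ((shiftUnitary H : EllTwo ℤ H →L[ℂ] EllTwo ℤ H) x) m -
      (shiftUnitary H : EllTwo ℤ H →L[ℂ] EllTwo ℤ H) (halfSpaceProj δ S N x) m = _
    rw [halfSpaceProj_apply, shiftUnitary_apply, shiftUnitary_apply, halfSpaceProj_apply]
  refine ⟨_, ?_, (EllTwo.eq_singleLinear (i := c) fun m hm => ?_).symm⟩
  · erw [hz]
    refine Submodule.sub_mem _ ?_ ?_ <;> split_ifs <;>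
      first | exact finProj_mem _ _ _ | exact zero_mem _
  · erw [hz]
    simp only [hS m hm, sub_self]

end Commutators

/-! ### The index of the compressed shift -/

section ShiftIndex

variable {H : Type*} [NormedAddCommGroup H] [InnerProductSpace ℂ H] [CompleteSpace H] {J : Type*}

/-- The compression `P T P + (1 - P)` of an operator on `ℓ²(ℤ) ⊗ H` to `halfSpace δ S N`. -/
def compression (δ : J → H) (S : Set ℤ) (N : Finset J) (T : EllTwo ℤ H →L[ℂ] EllTwo ℤ H) :
    EllTwo ℤ H →L[ℂ] EllTwo ℤ H :=
  halfSpaceProj δ S N * T * halfSpaceProj δ S N + (1 - halfSpaceProj δ S N)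

theorem star_shiftUnitary_apply (x : EllTwo ℤ H) (m : ℤ) :
    (star (shiftUnitary H : EllTwo ℤ H →L[ℂ] EllTwo ℤ H)) x m = x (m + 1) := by
  have h : (shiftUnitary H : EllTwo ℤ H →L[ℂ] EllTwo ℤ H)
      ((star (shiftUnitary H : EllTwo ℤ H →L[ℂ] EllTwo ℤ H)) x) = x :=
    congrArg (fun T : EllTwo ℤ H →L[ℂ] EllTwo ℤ H => T x)
      (Unitary.mul_star_self_of_mem (shiftUnitary H).2)
  have := congrArg (fun y : EllTwo ℤ H => y (m + 1)) h
  simpa [shiftUnitary_apply] using this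

open Classical in
theorem compression_shift_apply (δ : J → H) (S : Set ℤ) (N : Finset J) (x : EllTwo ℤ H) (m : ℤ) :
    compression δ S N (shiftUnitary H) x m =
      (if m ∈ S ∧ m - 1 ∈ S then finProj δ N (x (m - 1)) else 0) +
        (x m - if m ∈ S then finProj δ N (x m) else 0) := by
  show halfSpaceProj δ S N ((shiftUnitary H : EllTwo ℤ H →L[ℂ] EllTwo ℤ H)
    (halfSpaceProj δ S N x)) m +
    (x m - halfSpaceProj δ S N x m) = _
  rw [halfSpaceProj_apply, shiftUnitary_apply, halfSpaceProj_apply, halfSpaceProj_apply]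
  congr 1
  by_cases h : m ∈ S <;> by_cases h' : m - 1 ∈ S <;> simp [h, h', finProj_idem]

open Classical in
theorem compression_star_shift_apply (δ : J → H) (S : Set ℤ) (N : Finset J) (x : EllTwo ℤ H)
    (m : ℤ) :
    compression δ S N (star (shiftUnitary H : EllTwo ℤ H →L[ℂ] EllTwo ℤ H)) x m =
      (if m ∈ S ∧ m + 1 ∈ S then finProj δ N (x (m + 1)) else 0) +
        (x m - if m ∈ S then finProj δ N (x m) else 0) := by
  show halfSpaceProj δ S N (star (shiftUnitary H : EllTwo ℤ H →L[ℂ] EllTwo ℤ H)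
    (halfSpaceProj δ S N x)) m + (x m - halfSpaceProj δ S N x m) = _
  rw [halfSpaceProj_apply, star_shiftUnitary_apply, halfSpaceProj_apply, halfSpaceProj_apply]
  congr 1
  by_cases h : m ∈ S <;> by_cases h' : m + 1 ∈ S <;> simp [h, h', finProj_idem]

/-- The forward shift maps the half-line `c ≤ m` into itself, so compressing it discards nothing and
the compressed backward shift undoes it. -/
theorem compression_star_shift_leftInverse (δ : J → H) (c : ℤ) (N : Finset J) (x : EllTwo ℤ H) :
    compression δ {m | c ≤ m} N (star (shiftUnitary H : EllTwo ℤ H →L[ℂ] EllTwo ℤ H))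
      (compression δ {m | c ≤ m} N (shiftUnitary H) x) = x := by
  classical
  ext m
  simp only [compression_star_shift_apply, compression_shift_apply, Set.mem_ofPred_eq,
    add_sub_cancel_right]
  by_cases h : c ≤ m
  · have h1 : c ≤ m + 1 := by omega
    -- The position of `m - 1` decides only whether a term `p x(m - 1)` occurs; the factor `1 - p`
    -- removes it in either case.
    by_cases h2 : c ≤ m - 1 <;> simp [h, h1, h2, finProj_idem]
  · simp [h]

/-- On the half-line `m ≤ c` the backward shift is the one that stays inside, so the two
compressions exchange roles. -/
theorem compression_shift_leftInverse (δ : J → H) (c : ℤ) (N : Finset J) (x : EllTwo ℤ H) :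
    compression δ {m | m ≤ c} N (shiftUnitary H)
      (compression δ {m | m ≤ c} N (star (shiftUnitary H : EllTwo ℤ H →L[ℂ] EllTwo ℤ H)) x)
        = x := by
  classical
  ext m
  simp only [compression_star_shift_apply, compression_shift_apply, Set.mem_ofPred_eq,
    sub_add_cancel]
  by_cases h : m ≤ c
  · have h1 : m - 1 ≤ c := by omega
    by_cases h2 : m + 1 ≤ c <;> simp [h, h1, h2, finProj_idem]
  · simp [h]

theorem finrank_map_singleLinear {δ : J → H} (hδ : Orthonormal ℂ δ) (N : Finset J) (c : ℤ) :
    finrank ℂ ((finSpan δ N).map (EllTwo.singleLinear c)) = N.card := by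
  rw [← finrank_finSpan hδ N]
  exact (Submodule.equivMapOfInjective _ (EllTwo.singleLinear_injective c) _).finrank_eq.symm

/-- For `c ≤ m` a kernel vector satisfies `p x(m + 1) + (1 - p) x(m) = 0`, and the two terms are
orthogonal. Hence `x(m)` lies in the range of `p` while `p x(m + 1) = 0`, which kills every fibre
above `c`. Below `c` the compression is the identity, so only `x(c)` remains free. -/
theorem ker_compression_star_shift (δ : J → H) (c : ℤ) (N : Finset J) :
    LinearMap.ker (compression δ {m | c ≤ m} N
      (star (shiftUnitary H : EllTwo ℤ H →L[ℂ] EllTwo ℤ H)) : EllTwo ℤ H →ₗ[ℂ] EllTwo ℤ H) =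
      (finSpan δ N).map (EllTwo.singleLinear c) := by
  classical
  ext x
  constructor
  · intro hx
    have hx' : ∀ m, compression δ {m | c ≤ m} N
        (star (shiftUnitary H : EllTwo ℤ H →L[ℂ] EllTwo ℤ H)) x m = 0 := fun m =>
      congrArg (fun y : EllTwo ℤ H => y m) hx
    simp only [compression_star_shift_apply, Set.mem_ofPred_eq] at hx'
    have h1 : ∀ m, c ≤ m → finProj δ N (x (m + 1)) = 0 ∧ x m = finProj δ N (x m) := by
      intro m hm
      have h := hx' m
      rw [if_pos ⟨hm, by omega⟩, if_pos hm] at h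
      -- Applying `p` isolates the first term of the equation; what is left is the second.
      have h' := congrArg (finProj δ N) h
      simp only [map_add, map_sub, finProj_idem, sub_self, add_zero, map_zero] at h'
      rw [h', zero_add] at h
      exact ⟨h', sub_eq_zero.1 h⟩
    refine ⟨x c, finProj_eq_self.1 (h1 c le_rfl).2.symm,
      (EllTwo.eq_singleLinear fun m hm => ?_).symm⟩
    rcases lt_or_gt_of_ne hm with h | h
    · have := hx' m
      simpa [not_le.2 h] using this
    -- The equation of the preceding fibre gives `p x(m) = 0`, and that of the fibre `m` gives `x(m)
    -- = p x(m)`.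
    · have h2 := (h1 (m - 1) (by omega)).1
      rw [sub_add_cancel] at h2
      rw [(h1 m h.le).2, h2]
  · rintro ⟨v, hv, rfl⟩
    rw [LinearMap.mem_ker]
    ext m
    show compression δ {m | c ≤ m} N (star (shiftUnitary H : EllTwo ℤ H →L[ℂ] EllTwo ℤ H))
      (EllTwo.singleLinear c v) m = 0
    rw [compression_star_shift_apply, EllTwo.singleLinear_apply]
    by_cases h : m = c
    · subst h
      simp [finProj_eq_self.2 hv]
    -- The backward shift would carry `v` to the fibre `c - 1`, which lies outside the half-line, so
    -- the compression drops it.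
    · by_cases h' : m + 1 = c
      · have h1 : ¬ c ≤ m := by omega
        simp [h, h1]
      · simp [h, h']

/-- This is the mirror image of `ker_compression_star_shift` under reversal of the direction of `ℤ`:
the forward shift pushes the top fibre `c` out of the half-line `m ≤ c`. -/
theorem ker_compression_shift (δ : J → H) (c : ℤ) (N : Finset J) :
    LinearMap.ker (compression δ {m | m ≤ c} N (shiftUnitary H) :
      EllTwo ℤ H →ₗ[ℂ] EllTwo ℤ H) = (finSpan δ N).map (EllTwo.singleLinear c) := by
  classical
  ext x
  constructor
  · intro hx
    have hx' : ∀ m, compression δ {m | m ≤ c} N (shiftUnitary H) x m = 0 := fun m =>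
      congrArg (fun y : EllTwo ℤ H => y m) hx
    simp only [compression_shift_apply, Set.mem_ofPred_eq] at hx'
    have h1 : ∀ m, m ≤ c → finProj δ N (x (m - 1)) = 0 ∧ x m = finProj δ N (x m) := by
      intro m hm
      have h := hx' m
      rw [if_pos ⟨hm, by omega⟩, if_pos hm] at h
      have h' := congrArg (finProj δ N) h
      simp only [map_add, map_sub, finProj_idem, sub_self, add_zero, map_zero] at h'
      rw [h', zero_add] at h
      exact ⟨h', sub_eq_zero.1 h⟩
    refine ⟨x c, finProj_eq_self.1 (h1 c le_rfl).2.symm,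
      (EllTwo.eq_singleLinear fun m hm => ?_).symm⟩
    rcases lt_or_gt_of_ne hm with h | h
    · have h2 := (h1 (m + 1) (by omega)).1
      rw [add_sub_cancel_right] at h2
      rw [(h1 m h.le).2, h2]
    · have := hx' m
      simpa [not_le.2 h] using this
  · rintro ⟨v, hv, rfl⟩
    rw [LinearMap.mem_ker]
    ext m
    show compression δ {m | m ≤ c} N (shiftUnitary H) (EllTwo.singleLinear c v) m = 0
    rw [compression_shift_apply, EllTwo.singleLinear_apply]
    by_cases h : m = c
    · subst h
      simp [finProj_eq_self.2 hv]
    · by_cases h' : m - 1 = c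
      · have h1 : ¬ m ≤ c := by omega
        simp [h, h1]
      · simp [h, h']

theorem fredholmIndex_compression_shift_ge {δ : J → H} (hδ : Orthonormal ℂ δ) (c : ℤ)
    (N : Finset J) :
    fredholmIndex (compression δ {m | c ≤ m} N (shiftUnitary H) :
      EllTwo ℤ H →ₗ[ℂ] EllTwo ℤ H) = -(N.card : ℤ) := by
  rw [fredholmIndex_of_leftInverse (S := (compression δ {m | c ≤ m} N
    (star (shiftUnitary H : EllTwo ℤ H →L[ℂ] EllTwo ℤ H)) : EllTwo ℤ H →ₗ[ℂ] EllTwo ℤ H))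
    (compression_star_shift_leftInverse δ c N), ker_compression_star_shift,
    finrank_map_singleLinear hδ]

/-- Here the compressed shift is the surjective member of the pair, so the fibre `c` contributes to
its kernel and not to its cokernel. This reverses the sign. -/
theorem fredholmIndex_compression_shift_le {δ : J → H} (hδ : Orthonormal ℂ δ) (c : ℤ)
    (N : Finset J) :
    fredholmIndex (compression δ {m | m ≤ c} N (shiftUnitary H) :
      EllTwo ℤ H →ₗ[ℂ] EllTwo ℤ H) = (N.card : ℤ) := by
  rw [fredholmIndex_of_rightInverse (T := (compression δ {m | m ≤ c} N
    (star (shiftUnitary H : EllTwo ℤ H →L[ℂ] EllTwo ℤ H)) : EllTwo ℤ H →ₗ[ℂ] EllTwo ℤ H))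
    (compression_shift_leftInverse δ c N), ker_compression_shift,
    finrank_map_singleLinear hδ]

end ShiftIndex

/-! ### The cycles and their pairing with `[u]` -/

section Pairing

variable {A H : Type u} [CStarAlgebra A] [NormedAddCommGroup H] [InnerProductSpace ℂ H]
  [CompleteSpace H] {J : Type v}

/-- The cycle that belongs to a set `S` of integers whose indicator function jumps only once. -/
theorem isSummableCycleWithPairing_of_index [TopologicalSpace.SeparableSpace H]
    (α : A ≃⋆ₐ[ℂ] A) (π : A →⋆ₐ[ℂ] (H →L[ℂ] H)) {δ : J → H}
    (hπ : ∀ a n, ∃ c : ℂ, π a (δ n) = c • δ n) {S : Set ℤ} {c : ℤ}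
    (hS : ∀ m, m ≠ c → (m ∈ S ↔ m - 1 ∈ S)) (N : Finset J) {z : ℤ}
    (hz : fredholmIndex (compression δ S N (shiftUnitary H) :
      EllTwo ℤ H →ₗ[ℂ] EllTwo ℤ H) = z) :
    IsSummableCycleWithPairing α π (cycleOp δ S N) z := by
  have hU : hatRep α π (CrossedProduct.implementer α : CrossedProduct A α) = shiftUnitary H :=
    CrossedProduct.integrated_implementer _ _ _
  have hA : ∀ a, cycleOp δ S N * hatRep α π (CrossedProduct.ofBase α a) =
      hatRep α π (CrossedProduct.ofBase α a) * cycleOp δ S N := by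
    intro a
    have : hatRep α π (CrossedProduct.ofBase α a) = hatBase α π a :=
      CrossedProduct.integrated_ofBase _ _ _ _
    rw [this, ← sub_eq_zero, cycleOp_mul_sub, halfSpaceProj_comm_hatBase α π hπ, sub_self,
      smul_zero]
  have hU' : ((cycleOp δ S N * hatRep α π (CrossedProduct.implementer α : CrossedProduct A α) -
      hatRep α π (CrossedProduct.implementer α : CrossedProduct A α) * cycleOp δ S N :
        EllTwo ℤ H →L[ℂ] EllTwo ℤ H) : EllTwo ℤ H →ₗ[ℂ] EllTwo ℤ H).HasFiniteRange := by
    rw [hU, cycleOp_mul_sub]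
    exact (hasFiniteRange_commutator_shift δ hS N).smul 2
  have hc := fun x hx =>
    CrossedProduct.hasFiniteRange_commutator_of_mem_finiteSums (hatRep α π) _ hA hU' (x := x) hx
  have hF := cycleOp_mul_self δ S N
  have hF' := star_cycleOp δ S N
  have hd := CrossedProduct.dense_finiteSums α
  refine ⟨isOddFredholmModule_of_hasFiniteRange (hatRep α π) hF hF' hd hc,
    fun p hp => isSummableOn_of_hasFiniteRange (hatRep α π) hF hF' hd hc hp, ?_⟩
  -- The pairing is the index of a Toeplitz operator on `1 × 1` matrices over the Hilbert space,
  -- which is conjugate to the compression of the shift.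
  rw [indexPairing_mk, ← hz, compression, ← hU]
  exact fredholmIndex_toeplitz_unitaryToMatrix (hatRep α π) (halfSpaceProj δ S N) _

variable [TopologicalSpace.SeparableSpace H] (α : A ≃⋆ₐ[ℂ] A) (π : A →⋆ₐ[ℂ] (H →L[ℂ] H))
  {δ : J → H}

theorem isSummableCycleWithPairing_ge (hδ : Orthonormal ℂ δ)
    (hπ : ∀ a n, ∃ c : ℂ, π a (δ n) = c • δ n) (c : ℤ) (N : Finset J) :
    IsSummableCycleWithPairing α π (cycleOp δ {m | c ≤ m} N) (-(N.card : ℤ)) :=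
  isSummableCycleWithPairing_of_index α π hπ (c := c)
    (fun m hm => by simp only [Set.mem_ofPred_eq]; omega) N
    (fredholmIndex_compression_shift_ge hδ c N)

theorem isSummableCycleWithPairing_le (hδ : Orthonormal ℂ δ)
    (hπ : ∀ a n, ∃ c : ℂ, π a (δ n) = c • δ n) (c : ℤ) (N : Finset J) :
    IsSummableCycleWithPairing α π (cycleOp δ {m | m ≤ c} N) (N.card : ℤ) :=
  -- Membership is compared at `m` and `m - 1`, so the half-line `m ≤ c` jumps at `c + 1`, the first
  -- integer outside it; the half-line `c ≤ m` jumps at `c`.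
  isSummableCycleWithPairing_of_index α π hπ (c := c + 1)
    (fun m hm => by simp only [Set.mem_ofPred_eq]; omega) N
    (fredholmIndex_compression_shift_le hδ c N)

end Pairing

/-! ### The representations `π_τ` and the theorem -/

theorem piTau_deltaVec {X Y : Type*} [TopologicalSpace X] [CompactSpace X] (τ : Y → X)
    (f : C(X, ℂ)) (ν : Y) : ∃ c : ℂ, piTau τ f (deltaVec ν) = c • deltaVec ν := by
  classical
  refine ⟨f (τ ν), ?_⟩
  ext μ
  rw [piTau_apply, lp.coeFn_smul, Pi.smul_apply, smul_eq_mul]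
  by_cases h : μ = ν
  · rw [h]
  · simp [deltaVec, h]

/-- The cycles of a representation `π_τ` over a countable index set. -/
theorem isSummableCycleWithPairing_piTau {X Y : Type u} [TopologicalSpace X] [CompactSpace X]
    [Countable Y] (φ : X ≃ₜ X) (τ : Y → X) (N : Finset Y) :
    IsSummableCycleWithPairing (inducedAut φ) (piTau τ)
        (cycleOp deltaVec {m | 0 ≤ m} N) (-(N.card : ℤ)) ∧
      IsSummableCycleWithPairing (inducedAut φ) (piTau τ)
        (cycleOp deltaVec {m | m ≤ 0} N) (N.card : ℤ) :=
  ⟨isSummableCycleWithPairing_ge _ _ orthonormal_deltaVec (piTau_deltaVec τ) 0 N,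
    isSummableCycleWithPairing_le _ _ orthonormal_deltaVec (piTau_deltaVec τ) 0 N⟩

end

theorem mainTheorem7 :
    -- The general case, with the projections onto `m > 0` and onto `m < 0`.
    (∀ {X H : Type u} [TopologicalSpace X] [CompactSpace X] [T2Space X] (φ : X ≃ₜ X)
        [NormedAddCommGroup H] [InnerProductSpace ℂ H] [CompleteSpace H]
        [TopologicalSpace.SeparableSpace H] (π : C(X, ℂ) →⋆ₐ[ℂ] (H →L[ℂ] H))
        {J : Type v} (δ : HilbertBasis J ℂ H) (_ : ∀ a n, ∃ c : ℂ, π a (δ n) = c • δ n)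
        (N : Finset J),
      IsSummableCycleWithPairing (inducedAut φ) π (cycleOp δ {m | 0 < m} N) (-(N.card : ℤ)) ∧
      IsSummableCycleWithPairing (inducedAut φ) π (cycleOp δ {m | m < 0} N) (N.card : ℤ)) ∧
    -- The case `X = Ω^ℕ`.
    (∀ {Ω : Type u} [Finite Ω] [TopologicalSpace Ω] [DiscreteTopology Ω]
        (φ : (ℕ → Ω) ≃ₜ (ℕ → Ω)) (Y : Set (List Ω)) (τ : Y → (ℕ → Ω))
        (_ : ∀ μ : Y, τ μ ∈ cylinderNat (μ : List Ω)) (N : Finset Y),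
      IsSummableCycleWithPairing (inducedAut φ) (piTau τ)
        (cycleOp deltaVec {m | 0 ≤ m} N) (-(N.card : ℤ)) ∧
      IsSummableCycleWithPairing (inducedAut φ) (piTau τ)
        (cycleOp deltaVec {m | m ≤ 0} N) (N.card : ℤ)) ∧
    -- The case `X = Ω^ℤ`.
    (∀ {Ω : Type u} [Finite Ω] [TopologicalSpace Ω] [DiscreteTopology Ω]
        (φ : (ℤ → Ω) ≃ₜ (ℤ → Ω)) (Y : Set (List Ω)) (τ : Y → (ℤ → Ω))
        (_ : ∀ μ : Y, τ μ ∈ cylinderInt (μ : List Ω)) (N : Finset Y),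
      IsSummableCycleWithPairing (inducedAut φ) (piTau τ)
        (cycleOp deltaVec {m | 0 ≤ m} N) (-(N.card : ℤ)) ∧
      IsSummableCycleWithPairing (inducedAut φ) (piTau τ)
        (cycleOp deltaVec {m | m ≤ 0} N) (N.card : ℤ)) := by
  refine ⟨?_, ?_, ?_⟩
  · intro X H _ _ _ φ _ _ _ _ π J δ hδ N
    -- Strict inequalities become closed half-lines starting at `1` and ending at `-1`; the endpoint
    -- does not affect the index.
    have e1 : {m : ℤ | 0 < m} = {m : ℤ | 1 ≤ m} := rfl
    have e2 : {m : ℤ | m < 0} = {m : ℤ | m ≤ -1} := by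
      ext m
      simp only [Set.mem_ofPred_eq]
      omega
    rw [e1, e2]
    exact ⟨isSummableCycleWithPairing_ge _ π δ.orthonormal hδ 1 N,
      isSummableCycleWithPairing_le _ π δ.orthonormal hδ (-1) N⟩
  · intro Ω _ _ _ φ Y τ _ N
    -- There are only countably many words over a finite alphabet, which makes `ℓ²(Y)` separable.
    exact isSummableCycleWithPairing_piTau φ τ N
  · intro Ω _ _ _ φ Y τ _ N
    exact isSummableCycleWithPairing_piTau φ τ N
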